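/- **Setting.** Let $q=2s$ and let $w_1,\dots,w_s>0$ be distinct. For $\omega\in\mathbb R^s$ put $E(\omega)=\mathrm{bdiag}_{r=1}^{s}\begin{bmatrix}0&\omega_r\\-\omega_r&0\end{bmatrix}\in\mathbb R^{q\times q}$, and let $E=E(w)$. The leader is $\dot v=Ev$, and all its oscillators are excited: $(v_{2r-1}(0),v_{2r}(0))\neq(0,0)$ for $r=1,\dots,s$. The followers $i=1,\dots,N$ are $$\dot x_i=A_ix_i+B_iu_i+D_iv,\qquad e_i=C_ix_i+F_iv,$$ with real matrices and $x_i\in\mathbb R^{n_i}$, $u_i\in\mathbb R^{m_i}$, $e_i\in\mathbb R^{p_i}$. Let $a_{ij}=a_{ji}\ge 0$ be the edge weights of an undirected graph on the followers ($a_{ij}>0$ exactly when $i,j$ are adjacent, $a_{ii}=0$), and let $m_{ii}=1$ if follower $i$ is in direct contact with the leader, $m_{ii}=0$ otherwise. **Observer.** Let $\mathbb A_m=-\mathrm{bdiag}_{r=1}^{s}(a_rI_2)$ with $a_r>0$, and let $\kappa_r>0$. Each follower runs the distributed adaptive observer with states $\eta_i\in\mathbb R^q$, $\hat w_i\in\mathbb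 R^s$: $$\epsilon_i=\sum_{j=1}^N a_{ij}(\eta_i-\eta_j)+m_{ii}(\eta_i-v),\qquad \dot\eta_i=\hat E_i\eta_i+(\mathbb A_m-\hat E_i)\epsilon_i,\qquad \hat E_i=E(\hat w_i),$$ $$(\dot{\hat w}_r)_i=\kappa_r\big(\eta_{i,2r-1}\epsilon_{i,2r}-\eta_{i,2r}\epsilon_{i,2r-1}\big),\qquad r=1,\dots,s.$$ **Controller.** Let $u_i=-K_ix_i+\hat L_i\eta_i$ with $\hat L_i=K_i\hat X_i+\hat U_i$. Here $(\hat X_i,\hat U_i)$ is a function of the current estimate $\hat w_i$ which, whenever the regulator equations $$\hat X_i\hat E_i=A_i\hat X_i+B_i\hat U_i+D_i,\qquad 0=C_i\hat X_i+F_i$$ are solvable, is one of their solutions. For each $i$ this solution either is selected as the minimizer of $\mathrm{Tr}(X^{\mathsf T}\bar Q_iX+U^{\mathsf T}\bar R_iU)$ among all solutions, for some fixed symmetric positive definite $\bar Q_i,\bar R_i$ (this includes the case in which the solution is unique), or is any selection that, as a function of $\hat w_i$, is continuous at $w$. **Theorem.** Assume that 1. $(A_i,B_i)$ is stabilizable and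 $(C_i,A_i)$ is observable for every $i$; 2. at least one follower is in direct contact with the leader, and the graph on the followers is connected; 3. $\operatorname{rank}\begin{bmatrix}A_i-\lambda I&B_i\\C_i&0\end{bmatrix}=n_i+p_i$ for every eigenvalue $\lambda$ of $E$ and every $i$; 4. $A_i-B_iK_i$ is Hurwitz for every $i$. Then the closed loop achieves cooperative output regulation. That is, along every trajectory of the closed loop on $[0,\infty)$ and for every $i$: the states $x_i,\eta_i,\hat w_i$ are bounded; for all sufficiently large $t$ the regulator equations written with $\hat E_i(t)$ are solvable, so that $(\hat X_i,\hat U_i)$ solves them; and $$x_i-\hat X_i\eta_i\to 0,\qquad e_i\to 0\qquad\text{as } t\to\infty .$$ -/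

import Mathlib

open Filter Set
open scoped Topology Matrix

/-- The signal space `ℝ^q` with `q = 2 s`, organised in `s` blocks of length two:
`z (0, r)` and `z (1, r)` are the two components (the entries `2r-1` and `2r`) of block `r`. -/
abbrev ExoSpace (s : ℕ) : Type := Fin 2 × Fin s → ℝ

/-- The multi-dimensional harmonic oscillator matrix with frequencies `ω`:
block diagonal with blocks `[0, ω r; -ω r, 0]`. -/
def oscMatrix {s : ℕ} (ω : Fin s → ℝ) : Matrix (Fin 2 × Fin s) (Fin 2 × Fin s) ℝ :=
  Matrix.blockDiagonal fun r => !![0, ω r; -ω r, 0]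

/-- The observer matrix `-bdiag (a r • I₂)`. -/
def observerMatrix {s : ℕ} (a : Fin s → ℝ) : Matrix (Fin 2 × Fin s) (Fin 2 × Fin s) ℝ :=
  -Matrix.blockDiagonal fun r => a r • (1 : Matrix (Fin 2) (Fin 2) ℝ)

/-- A real square matrix is Hurwitz if all its complex eigenvalues have negative real part. -/
def IsHurwitz {n : ℕ} (A : Matrix (Fin n) (Fin n) ℝ) : Prop :=
  ∀ μ ∈ spectrum ℂ (A.map Complex.ofReal), μ.re < 0

/-- The pair `(A, B)` is stabilizable. -/
def IsStabilizable {n m : ℕ} (A : Matrix (Fin n) (Fin n) ℝ) (B : Matrix (Fin n) (Fin m) ℝ) :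
    Prop :=
  ∃ K : Matrix (Fin m) (Fin n) ℝ, IsHurwitz (A - B * K)

/-- The pair `(C, A)` is observable. -/
def IsObservable {n p : ℕ} (C : Matrix (Fin p) (Fin n) ℝ) (A : Matrix (Fin n) (Fin n) ℝ) :
    Prop :=
  ∀ x : Fin n → ℝ, (∀ k : ℕ, (C * A ^ k) *ᵥ x = 0) → x = 0

/-- The matrices of a follower
`x' = A x + B u + D v`, `e = C x + F v`. -/
structure Follower (n m p s : ℕ) where
  A : Matrix (Fin n) (Fin n) ℝ
  B : Matrix (Fin n) (Fin m) ℝ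
  C : Matrix (Fin p) (Fin n) ℝ
  D : Matrix (Fin n) (Fin 2 × Fin s) ℝ
  F : Matrix (Fin p) (Fin 2 × Fin s) ℝ

namespace Follower

variable {n m p s : ℕ} (f : Follower n m p s)

/-- The non-resonance condition: `[A - λ I, B; C, 0]` has full row rank `n + p` for every
(complex) eigenvalue `λ` of `E`. -/
def NonResonant (E : Matrix (Fin 2 × Fin s) (Fin 2 × Fin s) ℝ) : Prop :=
  ∀ μ ∈ spectrum ℂ (E.map Complex.ofReal),
    (Matrix.fromBlocks (f.A.map Complex.ofReal - μ • (1 : Matrix (Fin n) (Fin n) ℂ))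
      (f.B.map Complex.ofReal) (f.C.map Complex.ofReal)
      (0 : Matrix (Fin p) (Fin m) ℂ)).rank = n + p

/-- The solutions `(X, U)` of the regulator equations
`X S = A X + B U + D`, `0 = C X + F`. -/
def regulatorSolutions (S : Matrix (Fin 2 × Fin s) (Fin 2 × Fin s) ℝ) :
    Set (Matrix (Fin n) (Fin 2 × Fin s) ℝ × Matrix (Fin m) (Fin 2 × Fin s) ℝ) :=
  {z | z.1 * S = f.A * z.1 + f.B * z.2 + f.D ∧ 0 = f.C * z.1 + f.F}

/-- `sol` assigns to a vector `ω` of estimated frequencies a solution of the regulator equations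
written with the matrix of these frequencies, whenever there is one. -/
def IsSolutionRule (sol : (Fin s → ℝ) →
    Matrix (Fin n) (Fin 2 × Fin s) ℝ × Matrix (Fin m) (Fin 2 × Fin s) ℝ) : Prop :=
  ∀ ω, (f.regulatorSolutions (oscMatrix ω)).Nonempty → sol ω ∈ f.regulatorSolutions (oscMatrix ω)

/-- `sol` picks, among the solutions of the regulator equations, one that minimizes the cost
`Tr (Xᵀ Q X + Uᵀ R U)`. -/
def IsOptimalRule (Q : Matrix (Fin n) (Fin n) ℝ) (R : Matrix (Fin m) (Fin m) ℝ)
    (sol : (Fin s → ℝ) →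
      Matrix (Fin n) (Fin 2 × Fin s) ℝ × Matrix (Fin m) (Fin 2 × Fin s) ℝ) : Prop :=
  ∀ ω, ∀ z ∈ f.regulatorSolutions (oscMatrix ω),
    ((sol ω).1ᵀ * Q * (sol ω).1 + (sol ω).2ᵀ * R * (sol ω).2).trace
      ≤ (z.1ᵀ * Q * z.1 + z.2ᵀ * R * z.2).trace

/-- The tracking error `e = C x + F v`. -/
def trackingError (x : Fin n → ℝ) (v : ExoSpace s) : Fin p → ℝ :=
  f.C *ᵥ x + f.F *ᵥ v

end Follower

/-- The control input `u = -K x + L η` with `L = K X + U`. -/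
def controlInput {n m s : ℕ} (K : Matrix (Fin m) (Fin n) ℝ)
    (z : Matrix (Fin n) (Fin 2 × Fin s) ℝ × Matrix (Fin m) (Fin 2 × Fin s) ℝ)
    (x : Fin n → ℝ) (η : ExoSpace s) : Fin m → ℝ :=
  -(K *ᵥ x) + (K * z.1 + z.2) *ᵥ η

/-- A communication network of `N` followers and a leader: an undirected weighted graph on the
followers, and the set of the followers that are in direct contact with the leader. -/
structure Network (N : ℕ) where
  /-- the graph that is left when the leader is removed -/
  graph : SimpleGraph (Fin N)
  /-- the adjacency weights `a i j` -/
  weight : Fin N → Fin N → ℝ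
  weight_symm : ∀ i j, weight i j = weight j i
  weight_pos : ∀ i j, graph.Adj i j → 0 < weight i j
  weight_zero : ∀ i j, ¬ graph.Adj i j → weight i j = 0
  /-- the followers in direct contact with the leader -/
  targets : Set (Fin N)

namespace Network

variable {N s : ℕ} (𝒢 : Network N)

open Classical in
/-- The diagonal entry `m i i` of the target matrix. -/
noncomputable def targetGain (i : Fin N) : ℝ := if i ∈ 𝒢.targets then 1 else 0

/-- The local observation error `ε i = ∑ j, a i j (η i - η j) + m i i (η i - v)`. -/
noncomputable def observationError (η : Fin N → ExoSpace s) (v : ExoSpace s) (i : Fin N) :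
    ExoSpace s :=
  (∑ j, 𝒢.weight i j • (η i - η j)) + 𝒢.targetGain i • (η i - v)

end Network

/-- The functions `v`, `x`, `η`, `wh` on `[0, ∞)` form a trajectory of the closed loop made of the
exosystem with frequencies `w`, the followers `f i`, the distributed adaptive observers
with states `(η i, wh i)`, and the controllers `u i = -K i x i + (K i X i + U i) η i`, where
`(X i, U i) = sol i (wh i)`. -/
structure IsClosedLoopTrajectory {N s : ℕ} {n m p : Fin N → ℕ}
    (𝒢 : Network N) (f : ∀ i, Follower (n i) (m i) (p i) s)
    (w a κ : Fin s → ℝ)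
    (K : ∀ i, Matrix (Fin (m i)) (Fin (n i)) ℝ)
    (sol : ∀ i, (Fin s → ℝ) →
      Matrix (Fin (n i)) (Fin 2 × Fin s) ℝ × Matrix (Fin (m i)) (Fin 2 × Fin s) ℝ)
    (v : ℝ → ExoSpace s) (x : ∀ i, ℝ → Fin (n i) → ℝ)
    (η : Fin N → ℝ → ExoSpace s) (wh : Fin N → ℝ → Fin s → ℝ) : Prop where
  exosystem : ∀ t, 0 ≤ t → HasDerivWithinAt v (oscMatrix w *ᵥ v t) (Ici 0) t
  follower : ∀ i t, 0 ≤ t → HasDerivWithinAt (x i)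
    ((f i).A *ᵥ x i t + (f i).B *ᵥ controlInput (K i) (sol i (wh i t)) (x i t) (η i t)
      + (f i).D *ᵥ v t) (Ici 0) t
  observer : ∀ i t, 0 ≤ t → HasDerivWithinAt (η i)
    (oscMatrix (wh i t) *ᵥ η i t + (observerMatrix a - oscMatrix (wh i t)) *ᵥ
      𝒢.observationError (fun j => η j t) (v t) i) (Ici 0) t
  adaptation : ∀ i r t, 0 ≤ t → HasDerivWithinAt (fun τ => wh i τ r)
    (κ r * (η i t (0, r) * 𝒢.observationError (fun j => η j t) (v t) i (1, r)
      - η i t (1, r) * 𝒢.observationError (fun j => η j t) (v t) i (0, r))) (Ici 0) t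

/-! The proof is a certainty equivalence argument: the estimates converge to the truth, the
regulator solution depends continuously on the frequencies at the true value, and a stabilized
follower tolerates an asymptotically vanishing input error.

Observer. The network observer splits into one problem per oscillator, coupled across followers only
by the grounded Laplacian `H`, which is symmetric and, by connectivity and the presence of a target,
positive definite. With estimation errors `X`, `Y`, the function `(XᵀHX + YᵀHY)/2 + ∑ (W - w)²/(2κ)`
has derivative `-a(|HX|² + |HY|²)`: the adaptation law cancels the terms containing frequency
errors, and symmetry of `H` cancels the rotation. All signals are then bounded and Lipschitz, and
Barbalat's lemma gives `HX, HY → 0`, hence `X, Y → 0`. Barbalat applied to `X` and `Y` themselves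
shows that `(W - w)q` and `(W - w)p` vanish; since `p² + q²` is conserved and nonzero, `W → w`
(`adaptive_observer_converges`).

Regulator equations. Reading the two columns of a block as one complex vector turns them into a
linear system for each `r`, with the Rosenbrock matrix at `i ω r`. Nonresonance makes it right
invertible at `w`. So the equations are solvable near `w`, every solution at `w` extends to a
continuous family (`exists_continuousAt_solution`), and the minimizer of a positive definite cost is
continuous at `w` (`continuousAt_of_isMinimizer`).

Tracking. With `X₀` the selected solution at `w`, `x - X₀ v` obeys a Hurwitz equation with vanishing
input, so it tends to zero (`regulation_of_estimates`). -/

/-! ### Stable linear systems with vanishing input -/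

theorem tendsto_zero_of_deriv_le {u u' h : ℝ → ℝ} {c : ℝ} (hc : 0 < c)
    (hu : ∀ t, 0 ≤ t → HasDerivWithinAt u (u' t) (Ici 0) t) (hu0 : ∀ t, 0 ≤ u t)
    (hle : ∀ t, 0 ≤ t → u' t ≤ -c * u t + h t) (hh : Tendsto h atTop (𝓝 0)) :
    Tendsto u atTop (𝓝 0) := by
  rw [Metric.tendsto_atTop]
  intro ε hε
  obtain ⟨T, hT⟩ := eventually_atTop.1 (hh.eventually_le_const (show 0 < c * (ε / 2) by positivity))
  set T₀ := max T 0
  have hder : ∀ t, 0 ≤ t → HasDerivWithinAt (fun t => (u t - ε / 2) * Real.exp (c * t))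
      (u' t * Real.exp (c * t) + (u t - ε / 2) * (Real.exp (c * t) * c)) (Ici 0) t := by
    intro t ht
    have h1 : HasDerivWithinAt (fun t : ℝ => c * t) c (Ici 0) t := by
      simpa using (hasDerivWithinAt_id t (Ici 0)).const_mul c
    exact ((hu t ht).sub_const _).mul h1.exp
  -- Once `h ≤ c ε / 2`, the excess `u - ε / 2` satisfies the homogeneous inequality, so multiplying
  -- it by `exp (c t)` gives a nonincreasing function. No integral of `h` appears, and nothing about
  -- `h` beyond its limit is needed.
  have hanti : AntitoneOn (fun t => (u t - ε / 2) * Real.exp (c * t)) (Ici T₀) := by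
    have hsub : Ici T₀ ⊆ Ici (0 : ℝ) := Ici_subset_Ici.2 (le_max_right _ _)
    refine antitoneOn_of_hasDerivWithinAt_nonpos (convex_Ici _)
      (fun t ht => ((hder t (hsub ht)).mono hsub).continuousWithinAt)
      (fun t ht => (hder t (hsub (interior_subset ht))).mono (interior_subset.trans hsub)) ?_
    intro t ht
    have ht' : T₀ ≤ t := interior_subset ht
    have h1 := hT t ((le_max_left _ _).trans ht')
    have h2 := hle t (hsub ht')
    have h3 : u' t * Real.exp (c * t) + (u t - ε / 2) * (Real.exp (c * t) * c)
        = (u' t + c * u t - c * (ε / 2)) * Real.exp (c * t) := by ring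
    rw [h3]
    exact mul_nonpos_of_nonpos_of_nonneg (by linarith) (Real.exp_pos _).le
  have hlim : Tendsto (fun t => (u T₀ - ε / 2) * Real.exp (c * T₀) * Real.exp (-(c * t)))
      atTop (𝓝 0) := by
    simpa using (Real.tendsto_exp_neg_atTop_nhds_zero.comp
      (tendsto_id.const_mul_atTop hc)).const_mul ((u T₀ - ε / 2) * Real.exp (c * T₀))
  obtain ⟨S, hS⟩ := eventually_atTop.1
    (hlim.eventually_lt_const (show 0 < ε / 2 by positivity))
  refine ⟨max S T₀, fun t ht => ?_⟩
  have h1 := hS t ((le_max_left _ _).trans ht)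
  have h2 := hanti self_mem_Ici ((le_max_right _ _).trans ht : T₀ ≤ t) ((le_max_right _ _).trans ht)
  have h3 : u t - ε / 2 ≤ (u T₀ - ε / 2) * Real.exp (c * T₀) * Real.exp (-(c * t)) := by
    have := mul_le_mul_of_nonneg_right h2 (Real.exp_pos (-(c * t))).le
    simpa [mul_assoc, ← Real.exp_add] using this
  rw [Real.dist_eq, sub_zero, abs_of_nonneg (hu0 t)]
  linarith

theorem tendsto_zero_of_complex_scalar_ode {z g : ℝ → ℂ} {μ : ℂ} (hμ : μ.re < 0)
    (hz : ∀ t, 0 ≤ t → HasDerivWithinAt z (μ * z t + g t) (Ici 0) t)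
    (hg : Tendsto g atTop (𝓝 0)) : Tendsto z atTop (𝓝 0) := by
  have hlim : Tendsto (fun t => ‖z t‖ ^ 2) atTop (𝓝 0) := by
    -- Young's inequality spends half of the decay `2 μ.re ‖z‖²` on absorbing the cross term with
    -- `g`; the rate `-μ.re` remains.
    refine tendsto_zero_of_deriv_le (h := fun t => ‖g t‖ ^ 2 / (-μ.re)) (neg_pos.2 hμ)
      (fun t ht => (hz t ht).norm_sq) (fun t => by positivity) ?_ ?_
    · intro t _
      have h1 : inner ℝ (z t) (μ * z t + g t) = μ.re * ‖z t‖ ^ 2 + inner ℝ (z t) (g t) := by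
        rw [inner_add_right]
        congr 1
        rw [Complex.inner, ← Complex.normSq_eq_norm_sq, Complex.normSq_apply]
        simp
        ring
      have h2 := real_inner_le_norm (z t) (g t)
      have h3 : 2 * (‖z t‖ * ‖g t‖) ≤ (-μ.re) * ‖z t‖ ^ 2 + ‖g t‖ ^ 2 / (-μ.re) := by
        have hc : 0 < -μ.re := neg_pos.2 hμ
        have h4 : 0 ≤ ((-μ.re) * ‖z t‖ - ‖g t‖) ^ 2 / (-μ.re) := by positivity
        have h5 : ((-μ.re) * ‖z t‖ - ‖g t‖) ^ 2 / (-μ.re)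
            = (-μ.re) * ‖z t‖ ^ 2 + ‖g t‖ ^ 2 / (-μ.re) - 2 * (‖z t‖ * ‖g t‖) := by
          have := hc.ne'
          generalize -μ.re = c at *
          field_simp
          ring
        linarith
      rw [h1]
      linarith
    · simpa using ((hg.norm).pow 2).div_const (-μ.re)
  rw [tendsto_zero_iff_norm_tendsto_zero]
  simpa using hlim.sqrt

theorem hasDerivWithinAt_mulVec {𝕜 : Type*} [NontriviallyNormedField 𝕜] [NormedAlgebra ℝ 𝕜]
    {m n : Type*} [Fintype m] [Fintype n] (M : Matrix m n 𝕜)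
    {y : ℝ → n → 𝕜} {y' : n → 𝕜} {S : Set ℝ} {t : ℝ} (hy : HasDerivWithinAt y y' S t) :
    HasDerivWithinAt (fun t => M *ᵥ y t) (M *ᵥ y') S t := by
  rw [hasDerivWithinAt_pi] at hy ⊢
  intro i
  exact HasDerivWithinAt.fun_sum fun j _ => (hy j).const_mul (M i j)

theorem tendsto_mulVec_zero {𝕜 : Type*} [NontriviallyNormedField 𝕜] {m n : Type*}
    [Fintype n] (M : Matrix m n 𝕜) {α : Type*} {l : Filter α}
    {y : α → n → 𝕜} (hy : Tendsto y l (𝓝 0)) : Tendsto (fun t => M *ᵥ y t) l (𝓝 0) := by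
  have h : Continuous fun y : n → 𝕜 => M *ᵥ y := by fun_prop
  simpa [Function.comp_def] using (h.tendsto 0).comp hy

/-- Peeling off one factor `B = A - μ`: since `B` commutes with `A`, `B y` solves the same equation
with input `B d`, and the remaining factors handle it by induction. Then `y' = μ y + (B y + d)` is a
family of stable scalar equations. This replaces the Jordan form and the matrix exponential. -/
theorem tendsto_zero_of_linear_ode_of_prod {n : ℕ} (A : Matrix (Fin n) (Fin n) ℂ) (l : List ℂ) :
    ∀ y d : ℝ → Fin n → ℂ, (∀ μ ∈ l, μ.re < 0) →
    (∀ t, 0 ≤ t → HasDerivWithinAt y (A *ᵥ y t + d t) (Ici 0) t) →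
    Tendsto d atTop (𝓝 0) →
    Tendsto (fun t => (l.map fun μ => A - algebraMap ℂ _ μ).prod *ᵥ y t) atTop (𝓝 0) →
    Tendsto y atTop (𝓝 0) := by
  induction l with
  | nil => intro y d _ _ _ h; simpa using h
  | cons μ l ih =>
    intro y d hl hy hd hp
    set B := A - algebraMap ℂ (Matrix (Fin n) (Fin n) ℂ) μ with hB
    have hcomm : Commute A B := (Commute.refl A).sub_right (Algebra.commutes μ A).symm
    have hcommp : Commute (l.map fun μ => A - algebraMap ℂ _ μ).prod B := by
      refine Commute.list_prod_left _ _ fun C hC => ?_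
      obtain ⟨ν, _, rfl⟩ := List.mem_map.1 hC
      exact hcomm.sub_left (Algebra.commutes ν B)
    have hz : Tendsto (fun t => B *ᵥ y t) atTop (𝓝 0) := by
      refine ih _ (fun t => B *ᵥ d t) (fun ν hν => hl ν (List.mem_cons_of_mem _ hν)) ?_
        (tendsto_mulVec_zero B hd) ?_
      · intro t ht
        have := hasDerivWithinAt_mulVec B (hy t ht)
        rwa [Matrix.mulVec_add, Matrix.mulVec_mulVec, ← hcomm.eq, ← Matrix.mulVec_mulVec] at this
      · simpa [Matrix.mulVec_mulVec, hcommp.eq, ← hB] using hp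
    rw [tendsto_pi_nhds]
    intro i
    refine tendsto_zero_of_complex_scalar_ode (g := fun t => (B *ᵥ y t) i + d t i)
      (hl μ List.mem_cons_self) ?_ ?_
    · intro t ht
      have h1 := hasDerivWithinAt_pi.1 (hy t ht) i
      have h2 : A *ᵥ y t = μ • y t + B *ᵥ y t := by
        rw [hB, Matrix.sub_mulVec, Matrix.algebraMap_eq_diagonal]
        ext j
        simp [Matrix.mulVec_diagonal]
      rw [h2] at h1
      simpa [add_assoc] using h1
    · simpa using (tendsto_pi_nhds.1 hz i).add (tendsto_pi_nhds.1 hd i)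

theorem IsHurwitz.tendsto_zero_of_linear_ode {n : ℕ} {A : Matrix (Fin n) (Fin n) ℝ}
    (hA : IsHurwitz A) {y d : ℝ → Fin n → ℝ}
    (hy : ∀ t, 0 ≤ t → HasDerivWithinAt y (A *ᵥ y t + d t) (Ici 0) t)
    (hd : Tendsto d atTop (𝓝 0)) : Tendsto y atTop (𝓝 0) := by
  set A' := A.map Complex.ofReal with hA'
  -- Cayley–Hamilton, with the characteristic polynomial split over `ℂ`: the product over all
  -- eigenvalues annihilates every vector.
  have hroots : (A'.charpoly.roots.toList.map fun μ => A' - algebraMap ℂ _ μ).prod = 0 := by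
    have h1 := Matrix.aeval_self_charpoly A'
    rw [← IsAlgClosed.splits A'.charpoly |>.eq_prod_roots_of_monic (Matrix.charpoly_monic A') |>.symm,
      ← Multiset.coe_toList A'.charpoly.roots, Multiset.map_coe, Multiset.prod_coe,
      map_list_prod, List.map_map] at h1
    simpa [Function.comp_def] using h1
  have key := tendsto_zero_of_linear_ode_of_prod A' A'.charpoly.roots.toList
    (fun t i => (y t i : ℂ)) (fun t i => (d t i : ℂ)) ?_ ?_ ?_ (by rw [hroots]; simp)
  · rw [tendsto_pi_nhds] at key ⊢
    intro i
    exact (Complex.continuous_re.tendsto _).comp (key i)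
  · intro μ hμ
    refine hA μ ?_
    rw [Matrix.mem_spectrum_iff_isRoot_charpoly]
    exact Polynomial.isRoot_of_mem_roots (Multiset.mem_toList.1 hμ)
  · intro t ht
    rw [hasDerivWithinAt_pi]
    intro i
    refine (hasDerivWithinAt_pi.1 (hy t ht) i).ofReal_comp.congr_deriv ?_
    simp [hA', Matrix.mulVec, dotProduct]
  · rw [tendsto_pi_nhds] at hd ⊢
    intro i
    have := (Complex.continuous_ofReal.tendsto _).comp (hd i)
    simpa only [Pi.zero_apply, Complex.ofReal_zero, Function.comp_def] using this

/-! ### Bounded Lipschitz signals and Barbalat's lemma -/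

/-- On `[0, ∞)` the function is bounded and Lipschitz. -/
def IsBoundedLipschitz (f : ℝ → ℝ) : Prop :=
  ∃ M, 0 ≤ M ∧ (∀ t, 0 ≤ t → |f t| ≤ M) ∧ ∀ t, 0 ≤ t → ∀ τ, 0 ≤ τ → |f t - f τ| ≤ M * |t - τ|

namespace IsBoundedLipschitz

variable {f g : ℝ → ℝ}

theorem const (c : ℝ) : IsBoundedLipschitz fun _ => c :=
  ⟨|c|, abs_nonneg c, fun _ _ => le_rfl, fun t _ τ _ => by simp; positivity⟩

theorem add (hf : IsBoundedLipschitz f) (hg : IsBoundedLipschitz g) :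
    IsBoundedLipschitz fun t => f t + g t := by
  obtain ⟨M, hM, h1, h2⟩ := hf
  obtain ⟨L, hL, h3, h4⟩ := hg
  refine ⟨M + L, by positivity, fun t ht => (abs_add_le _ _).trans (add_le_add (h1 t ht) (h3 t ht)),
    fun t ht τ hτ => ?_⟩
  calc |f t + g t - (f τ + g τ)| = |(f t - f τ) + (g t - g τ)| := by ring_nf
    _ ≤ _ := abs_add_le _ _
    _ ≤ _ := add_le_add (h2 t ht τ hτ) (h4 t ht τ hτ)
    _ = _ := by ring

theorem mul (hf : IsBoundedLipschitz f) (hg : IsBoundedLipschitz g) :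
    IsBoundedLipschitz fun t => f t * g t := by
  obtain ⟨M, hM, h1, h2⟩ := hf
  obtain ⟨L, hL, h3, h4⟩ := hg
  refine ⟨M * L + M * L, by positivity, fun t ht => ?_, fun t ht τ hτ => ?_⟩
  · rw [abs_mul]
    have := mul_le_mul (h1 t ht) (h3 t ht) (abs_nonneg _) hM
    nlinarith [mul_nonneg hM hL]
  · calc |f t * g t - f τ * g τ| = |f t * (g t - g τ) + (f t - f τ) * g τ| := by ring_nf
      _ ≤ _ := abs_add_le _ _
      _ ≤ M * (L * |t - τ|) + (M * |t - τ|) * L := by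
        rw [abs_mul, abs_mul]
        exact add_le_add (mul_le_mul (h1 t ht) (h4 t ht τ hτ) (abs_nonneg _) hM)
          (mul_le_mul (h2 t ht τ hτ) (h3 τ hτ) (abs_nonneg _) (by positivity))
      _ = _ := by ring

theorem neg (hf : IsBoundedLipschitz f) : IsBoundedLipschitz fun t => -f t := by
  simpa using (const (-1)).mul hf

theorem sub (hf : IsBoundedLipschitz f) (hg : IsBoundedLipschitz g) :
    IsBoundedLipschitz fun t => f t - g t := by
  simpa [sub_eq_add_neg] using hf.add hg.neg

theorem sum {ι : Type*} (S : Finset ι) {F : ι → ℝ → ℝ} (h : ∀ i, IsBoundedLipschitz (F i)) :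
    IsBoundedLipschitz fun t => ∑ i ∈ S, F i t := by
  classical
  induction S using Finset.induction_on with
  | empty => simpa using const 0
  | insert a S ha ih => simpa [Finset.sum_insert ha] using (h a).add ih

theorem of_hasDerivWithinAt {f' : ℝ → ℝ} {M L : ℝ} (hf : ∀ t, 0 ≤ t → |f t| ≤ M)
    (hd : ∀ t, 0 ≤ t → HasDerivWithinAt f (f' t) (Ici 0) t) (hf' : ∀ t, 0 ≤ t → |f' t| ≤ L) :
    IsBoundedLipschitz f := by
  have hM : 0 ≤ M := (abs_nonneg _).trans (hf 0 le_rfl)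
  have hL : 0 ≤ L := (abs_nonneg _).trans (hf' 0 le_rfl)
  refine ⟨M + L, by positivity, fun t ht => (hf t ht).trans (by linarith), fun t ht τ hτ => ?_⟩
  have := (convex_Ici (0 : ℝ)).norm_image_sub_le_of_norm_hasDerivWithin_le
    (fun x hx => hd x hx) (fun x hx => hf' x hx) hτ ht
  rw [Real.norm_eq_abs, Real.norm_eq_abs] at this
  exact this.trans (mul_le_mul_of_nonneg_right (by linarith) (abs_nonneg _))

/-- Barbalat's lemma. -/
theorem tendsto_zero_of_hasDerivWithinAt (hg : IsBoundedLipschitz g) {c : ℝ}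
    (hd : ∀ t, 0 ≤ t → HasDerivWithinAt f (g t) (Ici 0) t) (hf : Tendsto f atTop (𝓝 c)) :
    Tendsto g atTop (𝓝 0) := by
  obtain ⟨M, hM, -, hlip⟩ := hg
  rw [Metric.tendsto_atTop]
  intro ε hε
  -- Over a window of length `h` the function `g` varies by at most `M h ≤ ε / 2`; the mean slope of
  -- `f` over the window is a value of `g` and tends to zero. The `+ 1` covers `M = 0`.
  set h := ε / (2 * (M + 1)) with hh
  have hpos : 0 < h := by positivity
  have hMh : M * h ≤ ε / 2 := by
    rw [hh, mul_div_assoc', div_le_div_iff₀ (by positivity) (by positivity)]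
    nlinarith
  have hdiff : Tendsto (fun t => (f (t + h) - f t) / h) atTop (𝓝 0) := by
    simpa using ((hf.comp (tendsto_atTop_add_const_right atTop h tendsto_id)).sub hf).div_const h
  obtain ⟨T, hT⟩ := Metric.tendsto_atTop.1 hdiff (ε / 2) (by positivity)
  refine ⟨max T 0, fun t ht => ?_⟩
  have ht0 : 0 ≤ t := (le_max_right _ _).trans ht
  obtain ⟨ξ, hξ, hslope⟩ := exists_hasDerivAt_eq_slope f g (show t < t + h by linarith)
    (fun τ hτ => ((hd τ (ht0.trans hτ.1)).mono fun _ hx => ht0.trans hx.1).continuousWithinAt)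
    (fun τ hτ => (hd τ (ht0.trans hτ.1.le)).hasDerivAt (Ici_mem_nhds (ht0.trans_lt hτ.1)))
  have h1 := hT t ((le_max_left _ _).trans ht)
  rw [Real.dist_eq, sub_zero] at h1 ⊢
  rw [add_sub_cancel_left] at hslope
  rw [← hslope] at h1
  have h2 := hlip t ht0 ξ (ht0.trans hξ.1.le)
  have h3 : |t - ξ| ≤ h := by rw [abs_le]; constructor <;> linarith [hξ.1, hξ.2]
  have h4 : |g t| ≤ |g t - g ξ| + |g ξ| := by simpa using abs_add_le (g t - g ξ) (g ξ)
  have h5 := mul_le_mul_of_nonneg_left h3 hM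
  linarith

end IsBoundedLipschitz

/-! ### Positive definite forms and the grounded Laplacian -/

/-- The constant is the minimum of `φ` on the compact unit sphere, carried to all vectors by
homogeneity. -/
theorem exists_pos_mul_norm_sq_le {V : Type*} [NormedAddCommGroup V] [NormedSpace ℝ V]
    [FiniteDimensional ℝ V] {φ : V → ℝ} (hφ : Continuous φ)
    (hhom : ∀ (c : ℝ) z, φ (c • z) = c ^ 2 * φ z) (hpos : ∀ z, z ≠ 0 → 0 < φ z) :
    ∃ c, 0 < c ∧ ∀ z, c * ‖z‖ ^ 2 ≤ φ z := by
  have : ProperSpace V := FiniteDimensional.proper ℝ V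
  have h0 : φ 0 = 0 := by simpa using hhom 0 0
  rcases (Metric.sphere (0 : V) 1).eq_empty_or_nonempty with hemp | hne
  · refine ⟨1, one_pos, fun z => ?_⟩
    rcases eq_or_ne z 0 with rfl | hz
    · simp [h0]
    · have : (‖z‖⁻¹ • z) ∈ Metric.sphere (0 : V) 1 := by simp [norm_smul, hz]
      simp [hemp] at this
  · obtain ⟨z₀, hz₀, hmin⟩ := (isCompact_sphere (0 : V) 1).exists_isMinOn hne hφ.continuousOn
    refine ⟨φ z₀, hpos _ (by rintro rfl; simp at hz₀), fun z => ?_⟩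
    rcases eq_or_ne z 0 with rfl | hz
    · simp [h0]
    · have hmem : (‖z‖⁻¹ • z) ∈ Metric.sphere (0 : V) 1 := by simp [norm_smul, hz]
      have h1 : φ z₀ ≤ φ (‖z‖⁻¹ • z) := hmin hmem
      rw [hhom] at h1
      have hn : 0 < ‖z‖ := norm_pos_iff.2 hz
      have h2 := mul_le_mul_of_nonneg_right h1 (sq_nonneg ‖z‖)
      have h3 : ‖z‖⁻¹ ^ 2 * φ z * ‖z‖ ^ 2 = φ z := by field_simp
      linarith

namespace Network

variable {N s : ℕ} (𝒢 : Network N)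

/-- The Laplacian of the graph on the followers plus the target matrix. -/
noncomputable def groundedLaplacian : Matrix (Fin N) (Fin N) ℝ :=
  Matrix.diagonal (fun i => ∑ j, 𝒢.weight i j + 𝒢.targetGain i) - Matrix.of 𝒢.weight

theorem groundedLaplacian_isSymm : 𝒢.groundedLaplacian.IsSymm := by
  refine Matrix.IsSymm.sub (Matrix.isSymm_diagonal _) ?_
  ext i j
  exact 𝒢.weight_symm j i

theorem groundedLaplacian_mulVec (z : Fin N → ℝ) (i : Fin N) :
    (𝒢.groundedLaplacian *ᵥ z) i
      = ∑ j, 𝒢.weight i j * (z i - z j) + 𝒢.targetGain i * z i := by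
  rw [groundedLaplacian, Matrix.sub_mulVec, Pi.sub_apply, Matrix.mulVec_diagonal]
  simp only [Matrix.mulVec, dotProduct, Matrix.of_apply, mul_sub, Finset.sum_sub_distrib,
    ← Finset.sum_mul]
  ring

theorem observationError_apply (η : Fin N → ExoSpace s) (v : ExoSpace s) (i : Fin N)
    (k : Fin 2) (r : Fin s) :
    𝒢.observationError η v i (k, r)
      = (𝒢.groundedLaplacian *ᵥ fun j => η j (k, r) - v (k, r)) i := by
  rw [groundedLaplacian_mulVec]
  simp [observationError]

theorem weight_nonneg (i j : Fin N) : 0 ≤ 𝒢.weight i j := by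
  by_cases h : 𝒢.graph.Adj i j
  · exact (𝒢.weight_pos i j h).le
  · exact (𝒢.weight_zero i j h).ge

theorem targetGain_nonneg (i : Fin N) : 0 ≤ 𝒢.targetGain i := by
  unfold targetGain
  split_ifs <;> norm_num

theorem two_mul_dotProduct_groundedLaplacian (z : Fin N → ℝ) :
    2 * (z ⬝ᵥ 𝒢.groundedLaplacian *ᵥ z)
      = ∑ i, ∑ j, 𝒢.weight i j * (z i - z j) ^ 2 + 2 * ∑ i, 𝒢.targetGain i * z i ^ 2 := by
  -- Exchanging the two indices, with symmetric weights, changes the sign of the difference.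
  have h1 : ∑ i, ∑ j, 𝒢.weight i j * (z i - z j) * z i
      = - ∑ i, ∑ j, 𝒢.weight i j * (z i - z j) * z j := by
    rw [Finset.sum_comm, ← Finset.sum_neg_distrib]
    refine Finset.sum_congr rfl fun i _ => ?_
    rw [← Finset.sum_neg_distrib]
    refine Finset.sum_congr rfl fun j _ => ?_
    rw [𝒢.weight_symm]
    ring
  have h2 : z ⬝ᵥ 𝒢.groundedLaplacian *ᵥ z
      = ∑ i, ∑ j, 𝒢.weight i j * (z i - z j) * z i + ∑ i, 𝒢.targetGain i * z i ^ 2 := by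
    rw [dotProduct, ← Finset.sum_add_distrib]
    refine Finset.sum_congr rfl fun i _ => ?_
    rw [groundedLaplacian_mulVec, ← Finset.sum_mul]
    ring
  have h3 : ∑ i, ∑ j, 𝒢.weight i j * (z i - z j) ^ 2
      = ∑ i, ∑ j, 𝒢.weight i j * (z i - z j) * z i
        - ∑ i, ∑ j, 𝒢.weight i j * (z i - z j) * z j := by
    simp only [← Finset.sum_sub_distrib]
    refine Finset.sum_congr rfl fun i _ => Finset.sum_congr rfl fun j _ => ?_
    ring
  rw [h2, h3]
  linarith

/-- If the form were not positive, all its nonnegative terms would vanish: `z` would be equal across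
every edge and zero at a target, hence zero along walks from every vertex. -/
theorem dotProduct_groundedLaplacian_pos (hT : 𝒢.targets.Nonempty) (hconn : 𝒢.graph.Connected)
    (z : Fin N → ℝ) (hz : z ≠ 0) : 0 < z ⬝ᵥ 𝒢.groundedLaplacian *ᵥ z := by
  have hA : ∀ i j, 0 ≤ 𝒢.weight i j * (z i - z j) ^ 2 := fun i j =>
    mul_nonneg (𝒢.weight_nonneg i j) (sq_nonneg _)
  have hB : ∀ i, 0 ≤ 𝒢.targetGain i * z i ^ 2 := fun i =>
    mul_nonneg (𝒢.targetGain_nonneg i) (sq_nonneg _)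
  have hA' : ∀ i, 0 ≤ ∑ j, 𝒢.weight i j * (z i - z j) ^ 2 := fun i =>
    Finset.sum_nonneg fun j _ => hA i j
  have hA'' : 0 ≤ ∑ i, ∑ j, 𝒢.weight i j * (z i - z j) ^ 2 := Finset.sum_nonneg fun i _ => hA' i
  have hB' : 0 ≤ ∑ i, 𝒢.targetGain i * z i ^ 2 := Finset.sum_nonneg fun i _ => hB i
  have hform := 𝒢.two_mul_dotProduct_groundedLaplacian z
  by_contra hle
  have h1 : ∑ i, ∑ j, 𝒢.weight i j * (z i - z j) ^ 2 = 0 := by linarith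
  have h2 : ∑ i, 𝒢.targetGain i * z i ^ 2 = 0 := by linarith
  have hadj : ∀ i j, 𝒢.graph.Adj i j → z i = z j := by
    intro i j hij
    have h3 := (Finset.sum_eq_zero_iff_of_nonneg fun i _ => hA' i).1 h1 i (Finset.mem_univ i)
    have h4 := (Finset.sum_eq_zero_iff_of_nonneg fun j _ => hA i j).1 h3 j (Finset.mem_univ j)
    have h5 := (mul_eq_zero.1 h4).resolve_left (𝒢.weight_pos i j hij).ne'
    exact sub_eq_zero.1 (pow_eq_zero_iff two_ne_zero |>.1 h5)
  have hwalk : ∀ i j, ∀ _ : 𝒢.graph.Walk i j, z i = z j := by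
    intro i j p
    induction p with
    | nil => rfl
    | cons h _ ih => exact (hadj _ _ h).trans ih
  obtain ⟨i₀, hi₀⟩ := hT
  have hzero : z i₀ = 0 := by
    have h3 := (Finset.sum_eq_zero_iff_of_nonneg fun i _ => hB i).1 h2 i₀ (Finset.mem_univ i₀)
    simpa [targetGain, hi₀] using h3
  refine hz (funext fun i => ?_)
  obtain ⟨p⟩ := hconn.preconnected i i₀
  exact (hwalk i i₀ p).trans hzero

end Network

/-! ### Lyapunov analysis of the observer of one oscillator -/

theorem HasDerivWithinAt.dotProduct_mulVec_self {ι : Type*} [Fintype ι] {H : Matrix ι ι ℝ}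
    (hH : H.IsSymm) {z : ℝ → ι → ℝ} {z' : ι → ℝ} {S : Set ℝ} {t : ℝ}
    (hz : HasDerivWithinAt z z' S t) :
    HasDerivWithinAt (fun t => z t ⬝ᵥ H *ᵥ z t) (2 * ((H *ᵥ z t) ⬝ᵥ z')) S t := by
  have h1 : HasDerivWithinAt (fun t => z t ⬝ᵥ H *ᵥ z t)
      (∑ i, (z' i * (H *ᵥ z t) i + z t i * (H *ᵥ z') i)) S t :=
    HasDerivWithinAt.fun_sum fun i _ => (hasDerivWithinAt_pi.1 hz i).mul
      (hasDerivWithinAt_pi.1 (hasDerivWithinAt_mulVec H hz) i)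
  convert h1 using 1
  have h2 : z t ⬝ᵥ H *ᵥ z' = (H *ᵥ z t) ⬝ᵥ z' := by
    rw [Matrix.dotProduct_mulVec, ← Matrix.mulVec_transpose, hH.eq]
  rw [Finset.sum_add_distrib, two_mul]
  congr 1
  · exact Finset.sum_congr rfl fun i _ => mul_comm _ _
  · exact h2.symm

theorem isBigO_one_mul {f g : ℝ → ℝ} {l : Filter ℝ} (hf : f =O[l] fun _ => (1 : ℝ))
    (hg : g =O[l] fun _ => (1 : ℝ)) : (fun t => f t * g t) =O[l] fun _ => (1 : ℝ) := by
  simpa using hf.mul hg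

theorem isBigO_one_of_sq_le {f : ℝ → ℝ} {C : ℝ} (h : ∀ t, 0 ≤ t → f t ^ 2 ≤ C) :
    f =O[𝓟 (Ici 0)] fun _ => (1 : ℝ) := by
  refine Asymptotics.IsBigO.of_bound (C + 1) ?_
  rw [eventually_principal]
  intro t ht
  have := h t ht
  rw [norm_one, mul_one, Real.norm_eq_abs, abs_le]
  constructor <;> nlinarith

theorem IsBoundedLipschitz.of_isBigO {f f' : ℝ → ℝ} (hf : f =O[𝓟 (Ici 0)] fun _ => (1 : ℝ))
    (hd : ∀ t, 0 ≤ t → HasDerivWithinAt f (f' t) (Ici 0) t)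
    (hf' : f' =O[𝓟 (Ici 0)] fun _ => (1 : ℝ)) : IsBoundedLipschitz f := by
  obtain ⟨M, hM⟩ := hf.bound
  obtain ⟨L, hL⟩ := hf'.bound
  rw [eventually_principal] at hM hL
  exact .of_hasDerivWithinAt (M := M) (L := L) (fun t ht => by simpa using hM t ht) hd
    (fun t ht => by simpa using hL t ht)

theorem IsBoundedLipschitz.tendsto_mul_zero {f g : ℝ → ℝ} (hf : IsBoundedLipschitz f)
    (hg : Tendsto g atTop (𝓝 0)) : Tendsto (fun t => f t * g t) atTop (𝓝 0) := by
  obtain ⟨M, hM, hb, -⟩ := hf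
  refine squeeze_zero_norm' (a := fun t => M * ‖g t‖) ?_ (by simpa using hg.norm.const_mul M)
  filter_upwards [eventually_ge_atTop 0] with t ht
  rw [norm_mul]
  exact mul_le_mul_of_nonneg_right (hb t ht) (norm_nonneg _)

theorem exists_tendsto_of_hasDerivWithinAt_nonpos {V V' : ℝ → ℝ} (hV : ∀ t, 0 ≤ V t)
    (hd : ∀ t, 0 ≤ t → HasDerivWithinAt V (V' t) (Ici 0) t) (hV' : ∀ t, 0 ≤ t → V' t ≤ 0) :
    AntitoneOn V (Ici 0) ∧ ∃ c, Tendsto V atTop (𝓝 c) := by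
  have hanti : AntitoneOn V (Ici 0) :=
    antitoneOn_of_hasDerivWithinAt_nonpos (convex_Ici _)
      (fun t ht => (hd t ht).continuousWithinAt)
      (fun t ht => (hd t (interior_subset ht)).mono interior_subset)
      (fun t ht => hV' t (interior_subset ht))
  refine ⟨hanti, ⨅ t, V (max t 0), ?_⟩
  have h1 : Antitone fun t => V (max t 0) := fun t τ h =>
    hanti (mem_Ici.2 (le_max_right _ _)) (mem_Ici.2 (le_max_right _ _)) (max_le_max_right 0 h)
  refine (tendsto_atTop_ciInf h1 ⟨0, ?_⟩).congr' ?_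
  · rintro _ ⟨t, rfl⟩
    exact hV _
  · filter_upwards [eventually_ge_atTop 0] with t ht
    rw [max_eq_left ht]

/-- Convergence of the distributed adaptive observer of a single oscillator `p' = w q`,
`q' = -w p`, for a symmetric positive definite coupling matrix `H`. -/
theorem adaptive_observer_converges {ι : Type*} [Fintype ι] [DecidableEq ι] {H : Matrix ι ι ℝ}
    (hH : H.IsSymm) (hpos : ∀ z : ι → ℝ, z ≠ 0 → 0 < z ⬝ᵥ H *ᵥ z) {w a κ : ℝ} (ha : 0 < a)
    (hκ : 0 < κ) {p q : ℝ → ℝ} {P Q W : ι → ℝ → ℝ} {ξ ζ : ℝ → ι → ℝ}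
    (hξ : ∀ t, ξ t = H *ᵥ fun j => P j t - p t) (hζ : ∀ t, ζ t = H *ᵥ fun j => Q j t - q t)
    (hp : ∀ t, 0 ≤ t → HasDerivWithinAt p (w * q t) (Ici 0) t)
    (hq : ∀ t, 0 ≤ t → HasDerivWithinAt q (-w * p t) (Ici 0) t)
    (hP : ∀ i t, 0 ≤ t → HasDerivWithinAt (P i)
      (W i t * Q i t - a * ξ t i - W i t * ζ t i) (Ici 0) t)
    (hQ : ∀ i t, 0 ≤ t → HasDerivWithinAt (Q i)
      (-W i t * P i t - a * ζ t i + W i t * ξ t i) (Ici 0) t)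
    (hW : ∀ i t, 0 ≤ t → HasDerivWithinAt (W i)
      (κ * (P i t * ζ t i - Q i t * ξ t i)) (Ici 0) t)
    (h0 : 0 < p 0 ^ 2 + q 0 ^ 2) (i : ι) :
    (IsBoundedLipschitz p ∧ IsBoundedLipschitz q ∧ IsBoundedLipschitz (P i) ∧
      IsBoundedLipschitz (Q i) ∧ IsBoundedLipschitz (W i)) ∧
    Tendsto (fun t => P i t - p t) atTop (𝓝 0) ∧ Tendsto (fun t => Q i t - q t) atTop (𝓝 0) ∧
    Tendsto (W i) atTop (𝓝 w) := by
  set X : ℝ → ι → ℝ := fun t j => P j t - p t with hX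
  set Y : ℝ → ι → ℝ := fun t j => Q j t - q t with hY
  have hXd : ∀ t, 0 ≤ t → HasDerivWithinAt X
      (fun j => (W j t * Q j t - a * ξ t j - W j t * ζ t j) - w * q t) (Ici 0) t := fun t ht =>
    hasDerivWithinAt_pi.2 fun j => (hP j t ht).sub (hp t ht)
  have hYd : ∀ t, 0 ≤ t → HasDerivWithinAt Y
      (fun j => (-W j t * P j t - a * ζ t j + W j t * ξ t j) - -w * p t) (Ici 0) t := fun t ht =>
    hasDerivWithinAt_pi.2 fun j => (hQ j t ht).sub (hq t ht)
  set V : ℝ → ℝ := fun t => (X t ⬝ᵥ H *ᵥ X t + Y t ⬝ᵥ H *ᵥ Y t) / 2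
    + ∑ j, (W j t - w) ^ 2 / (2 * κ) with hVdef
  set V' : ℝ → ℝ := fun t => -a * ∑ j, (ξ t j * ξ t j + ζ t j * ζ t j) with hV'def
  have hform : ∀ z : ι → ℝ, 0 ≤ z ⬝ᵥ H *ᵥ z := by
    intro z
    rcases eq_or_ne z 0 with rfl | hz
    · simp
    · exact (hpos z hz).le
  have hsq : ∀ t j, 0 ≤ (W j t - w) ^ 2 / (2 * κ) := fun t j => by positivity
  have hV0 : ∀ t, 0 ≤ V t := fun t =>
    add_nonneg (div_nonneg (add_nonneg (hform _) (hform _)) zero_le_two)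
      (Finset.sum_nonneg fun j _ => hsq t j)
  have hVd : ∀ t, 0 ≤ t → HasDerivWithinAt V (V' t) (Ici 0) t := by
    intro t ht
    have h1 := (((hXd t ht).dotProduct_mulVec_self hH).add
      ((hYd t ht).dotProduct_mulVec_self hH)).div_const 2
    have h2 : HasDerivWithinAt (fun t => ∑ j, (W j t - w) ^ 2 / (2 * κ))
        (∑ j, (W j t - w) * (P j t * ζ t j - Q j t * ξ t j)) (Ici 0) t := by
      refine HasDerivWithinAt.fun_sum fun j _ => ?_
      refine (((hW j t ht).sub_const w).pow 2 |>.div_const (2 * κ)).congr_deriv ?_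
      field_simp
      simp
      ring
    refine (h1.add h2).congr_deriv ?_
    -- The rotation at the true frequency does no work in the energy defined by `H`, because `H` is
    -- symmetric.
    have hskew : ∑ j, (ξ t j * Y t j - ζ t j * X t j) = 0 := by
      rw [Finset.sum_sub_distrib, sub_eq_zero]
      change ξ t ⬝ᵥ Y t = ζ t ⬝ᵥ X t
      rw [hξ, hζ, dotProduct_comm (H *ᵥ Y t), Matrix.dotProduct_mulVec, ← Matrix.mulVec_transpose,
        hH.eq]
    rw [← hξ, ← hζ, ← mul_add, mul_div_cancel_left₀ _ (two_ne_zero' ℝ)]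
    simp only [dotProduct, hV'def]
    rw [← Finset.sum_add_distrib, ← Finset.sum_add_distrib, Finset.mul_sum]
    have : ∀ j, ξ t j * (W j t * Q j t - a * ξ t j - W j t * ζ t j - w * q t)
        + ζ t j * (-W j t * P j t - a * ζ t j + W j t * ξ t j - -w * p t)
        + (W j t - w) * (P j t * ζ t j - Q j t * ξ t j)
        = -a * (ξ t j * ξ t j + ζ t j * ζ t j) + w * (ξ t j * Y t j - ζ t j * X t j) := by
      intro j
      simp only [hX, hY]
      ring
    simp only [this, Finset.sum_add_distrib, ← Finset.mul_sum, hskew]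
    ring
  have hV'0 : ∀ t, 0 ≤ t → V' t ≤ 0 := fun t _ => by
    rw [hV'def]
    have : 0 ≤ ∑ j, (ξ t j * ξ t j + ζ t j * ζ t j) :=
      Finset.sum_nonneg fun j _ => add_nonneg (mul_self_nonneg _) (mul_self_nonneg _)
    nlinarith
  obtain ⟨hanti, c, hc⟩ := exists_tendsto_of_hasDerivWithinAt_nonpos hV0 hVd hV'0
  have hVle : ∀ t, 0 ≤ t → V t ≤ V 0 := fun t ht => hanti self_mem_Ici ht ht
  obtain ⟨γ, hγ, hcoer⟩ := exists_pos_mul_norm_sq_le (φ := fun z : ι → ℝ => z ⬝ᵥ H *ᵥ z)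
    (by fun_prop) (fun c z => by simp [Matrix.mulVec_smul]; ring) hpos
  have hcomp : ∀ (z : ι → ℝ) j, z j ^ 2 ≤ (z ⬝ᵥ H *ᵥ z) / γ := by
    intro z j
    rw [le_div_iff₀ hγ]
    have h1 : |z j| ≤ ‖z‖ := norm_le_pi_norm z j
    have h2 : z j ^ 2 ≤ ‖z‖ ^ 2 := by
      rw [← sq_abs]
      exact pow_le_pow_left₀ (abs_nonneg _) h1 2
    nlinarith [hcoer z]
  -- boundedness
  have hpq : ∀ t, 0 ≤ t → p t ^ 2 + q t ^ 2 = p 0 ^ 2 + q 0 ^ 2 := by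
    intro t ht
    have := (convex_Ici (0 : ℝ)).norm_image_sub_le_of_norm_hasDerivWithin_le (C := 0)
      (f := fun t => p t ^ 2 + q t ^ 2)
      (fun τ hτ => ((hp τ hτ).pow 2).add ((hq τ hτ).pow 2))
      (fun τ hτ => by rw [norm_le_zero_iff]; simp; ring) self_mem_Ici ht
    simpa [sub_eq_zero] using this
  have bp : p =O[𝓟 (Ici 0)] fun _ => (1 : ℝ) :=
    isBigO_one_of_sq_le (C := p 0 ^ 2 + q 0 ^ 2) fun t ht => by
      rw [← hpq t ht]; exact le_add_of_nonneg_right (sq_nonneg _)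
  have bq : q =O[𝓟 (Ici 0)] fun _ => (1 : ℝ) :=
    isBigO_one_of_sq_le (C := p 0 ^ 2 + q 0 ^ 2) fun t ht => by
      rw [← hpq t ht]; exact le_add_of_nonneg_left (sq_nonneg _)
  have hsum0 : ∀ t, 0 ≤ ∑ j, (W j t - w) ^ 2 / (2 * κ) := fun t =>
    Finset.sum_nonneg fun j _ => hsq t j
  have bX : ∀ j, (fun t => X t j) =O[𝓟 (Ici 0)] fun _ => (1 : ℝ) := fun j =>
    isBigO_one_of_sq_le (C := 2 * V 0 / γ) fun t ht => (hcomp (X t) j).trans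
      (div_le_div_of_nonneg_right (by
        have h1 := hVle t ht
        have h2 := hform (Y t)
        have h3 := hsum0 t
        simp only [hVdef] at h1 ⊢
        linarith) hγ.le)
  have bY : ∀ j, (fun t => Y t j) =O[𝓟 (Ici 0)] fun _ => (1 : ℝ) := fun j =>
    isBigO_one_of_sq_le (C := 2 * V 0 / γ) fun t ht => (hcomp (Y t) j).trans
      (div_le_div_of_nonneg_right (by
        have h1 := hVle t ht
        have h2 := hform (X t)
        have h3 := hsum0 t
        simp only [hVdef] at h1 ⊢
        linarith) hγ.le)
  have bW' : ∀ j, (fun t => W j t - w) =O[𝓟 (Ici 0)] fun _ => (1 : ℝ) := fun j =>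
    isBigO_one_of_sq_le (C := 2 * κ * V 0) fun t ht => by
      have h1 := hVle t ht
      have h2 := hform (X t)
      have h3 := hform (Y t)
      have h4 := Finset.single_le_sum (fun j _ => hsq t j) (Finset.mem_univ j)
      have h5 : (W j t - w) ^ 2 / (2 * κ) ≤ V 0 := by
        simp only [hVdef] at h1 ⊢
        linarith
      rw [div_le_iff₀ (by positivity)] at h5
      linarith
  have b1 : (fun _ : ℝ => (1 : ℝ)) =O[𝓟 (Ici 0)] fun _ => (1 : ℝ) := Asymptotics.isBigO_refl _ _
  have bP : ∀ j, P j =O[𝓟 (Ici 0)] fun _ => (1 : ℝ) := fun j => by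
    simpa [hX] using (bX j).add bp
  have bQ : ∀ j, Q j =O[𝓟 (Ici 0)] fun _ => (1 : ℝ) := fun j => by
    simpa [hY] using (bY j).add bq
  have bW : ∀ j, W j =O[𝓟 (Ici 0)] fun _ => (1 : ℝ) := fun j => by
    simpa using (bW' j).add (b1.const_mul_left w)
  have hξ' : ∀ j, (fun t => ξ t j) = fun t => ∑ k, H j k * (P k t - p t) := fun j => by
    funext t
    rw [hξ]
    rfl
  have hζ' : ∀ j, (fun t => ζ t j) = fun t => ∑ k, H j k * (Q k t - q t) := fun j => by
    funext t
    rw [hζ]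
    rfl
  have bξ : ∀ j, (fun t => ξ t j) =O[𝓟 (Ici 0)] fun _ => (1 : ℝ) := fun j => by
    rw [hξ']
    exact Asymptotics.IsBigO.fun_sum fun k _ => (bX k).const_mul_left _
  have bζ : ∀ j, (fun t => ζ t j) =O[𝓟 (Ici 0)] fun _ => (1 : ℝ) := fun j => by
    rw [hζ']
    exact Asymptotics.IsBigO.fun_sum fun k _ => (bY k).const_mul_left _
  have lp : IsBoundedLipschitz p := .of_isBigO bp hp (bq.const_mul_left w)
  have lq : IsBoundedLipschitz q := .of_isBigO bq hq (bp.const_mul_left (-w))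
  have lP : ∀ j, IsBoundedLipschitz (P j) := fun j => .of_isBigO (bP j) (hP j)
    (((isBigO_one_mul (bW j) (bQ j)).sub ((bξ j).const_mul_left a)).sub
      (isBigO_one_mul (bW j) (bζ j)))
  have lQ : ∀ j, IsBoundedLipschitz (Q j) := fun j => .of_isBigO (bQ j) (hQ j)
    (((isBigO_one_mul (bW j).neg_left (bP j)).sub ((bζ j).const_mul_left a)).add
      (isBigO_one_mul (bW j) (bξ j)))
  have lW : ∀ j, IsBoundedLipschitz (W j) := fun j => .of_isBigO (bW j) (hW j)
    (((isBigO_one_mul (bP j) (bζ j)).sub (isBigO_one_mul (bQ j) (bξ j))).const_mul_left κ)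
  have lξ : ∀ j, IsBoundedLipschitz fun t => ξ t j := fun j => by
    rw [hξ']
    exact .sum _ fun k => (IsBoundedLipschitz.const _).mul ((lP k).sub lp)
  have lζ : ∀ j, IsBoundedLipschitz fun t => ζ t j := fun j => by
    rw [hζ']
    exact .sum _ fun k => (IsBoundedLipschitz.const _).mul ((lQ k).sub lq)
  -- convergence of the observation errors
  have hV'lim : Tendsto V' atTop (𝓝 0) := by
    refine IsBoundedLipschitz.tendsto_zero_of_hasDerivWithinAt ?_ hVd hc
    exact (IsBoundedLipschitz.const _).mul
      (.sum _ fun j => ((lξ j).mul (lξ j)).add ((lζ j).mul (lζ j)))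
  have hsumlim : Tendsto (fun t => ∑ j, (ξ t j * ξ t j + ζ t j * ζ t j)) atTop (𝓝 0) := by
    have := hV'lim.const_mul (-a⁻¹)
    simpa [hV'def, ← mul_assoc, ha.ne'] using this
  have hroot := hsumlim.sqrt
  rw [Real.sqrt_zero] at hroot
  have hterm : ∀ t j, ξ t j * ξ t j + ζ t j * ζ t j ≤ ∑ j, (ξ t j * ξ t j + ζ t j * ζ t j) :=
    fun t j => Finset.single_le_sum (f := fun j => ξ t j * ξ t j + ζ t j * ζ t j)
      (fun j _ => add_nonneg (mul_self_nonneg _) (mul_self_nonneg _)) (Finset.mem_univ j)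
  have ξlim : Tendsto ξ atTop (𝓝 0) := by
    refine tendsto_pi_nhds.2 fun j => squeeze_zero_norm (fun t => ?_) hroot
    refine Real.abs_le_sqrt ?_
    have := hterm t j
    nlinarith [mul_self_nonneg (ζ t j)]
  have ζlim : Tendsto ζ atTop (𝓝 0) := by
    refine tendsto_pi_nhds.2 fun j => squeeze_zero_norm (fun t => ?_) hroot
    refine Real.abs_le_sqrt ?_
    have := hterm t j
    nlinarith [mul_self_nonneg (ξ t j)]
  have hunit : IsUnit H := by
    rw [← Matrix.mulVec_injective_iff_isUnit]
    intro x y hxy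
    by_contra hne
    have h1 := hpos (x - y) (sub_ne_zero.2 hne)
    rw [Matrix.mulVec_sub, show H *ᵥ x = H *ᵥ y from hxy] at h1
    simp at h1
  have hdet : IsUnit H.det := (Matrix.isUnit_iff_isUnit_det H).1 hunit
  have Xlim : Tendsto X atTop (𝓝 0) := by
    refine (tendsto_mulVec_zero H⁻¹ ξlim).congr fun t => ?_
    rw [hξ, Matrix.mulVec_mulVec, Matrix.nonsing_inv_mul H hdet, Matrix.one_mulVec]
  have Ylim : Tendsto Y atTop (𝓝 0) := by
    refine (tendsto_mulVec_zero H⁻¹ ζlim).congr fun t => ?_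
    rw [hζ, Matrix.mulVec_mulVec, Matrix.nonsing_inv_mul H hdet, Matrix.one_mulVec]
  have Xi := tendsto_pi_nhds.1 Xlim i
  have Yi := tendsto_pi_nhds.1 Ylim i
  have ξi := tendsto_pi_nhds.1 ξlim i
  have ζi := tendsto_pi_nhds.1 ζlim i
  simp only [Pi.zero_apply] at Xi Yi ξi ζi
  refine ⟨⟨lp, lq, lP i, lQ i, lW i⟩, Xi, Yi, ?_⟩
  -- persistent excitation
  have d1 : Tendsto (fun t => (W i t * Q i t - a * ξ t i - W i t * ζ t i) - w * q t)
      atTop (𝓝 0) := by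
    refine IsBoundedLipschitz.tendsto_zero_of_hasDerivWithinAt ?_
      (fun t ht => hasDerivWithinAt_pi.1 (hXd t ht) i) Xi
    exact ((((lW i).mul (lQ i)).sub ((IsBoundedLipschitz.const _).mul (lξ i))).sub
      ((lW i).mul (lζ i))).sub ((IsBoundedLipschitz.const _).mul lq)
  have d2 : Tendsto (fun t => (-W i t * P i t - a * ζ t i + W i t * ξ t i) - -w * p t)
      atTop (𝓝 0) := by
    refine IsBoundedLipschitz.tendsto_zero_of_hasDerivWithinAt ?_
      (fun t ht => hasDerivWithinAt_pi.1 (hYd t ht) i) Yi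
    exact ((((lW i).neg.mul (lP i)).sub ((IsBoundedLipschitz.const _).mul (lζ i))).add
      ((lW i).mul (lξ i))).sub ((IsBoundedLipschitz.const _).mul lp)
  -- Substituting `Q = q + Y`, the derivative in `d1` equals `(W - w) q + W Y - a ξ - W ζ`, and all
  -- terms but the first are known to vanish.
  have e1 : Tendsto (fun t => (W i t - w) * q t) atTop (𝓝 0) := by
    have := ((d1.sub ((lW i).tendsto_mul_zero Yi)).add (ξi.const_mul a)).add
      ((lW i).tendsto_mul_zero ζi)
    simp only [mul_zero, sub_zero, add_zero] at this
    refine this.congr fun t => ?_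
    simp only [hY]
    ring
  have e2 : Tendsto (fun t => (W i t - w) * p t) atTop (𝓝 0) := by
    have := (((d2.add ((lW i).tendsto_mul_zero Xi)).add (ζi.const_mul a)).sub
      ((lW i).tendsto_mul_zero ξi)).neg
    simp only [mul_zero, sub_zero, add_zero, neg_zero] at this
    refine this.congr fun t => ?_
    simp only [hX]
    ring
  -- Multiplying by the bounded `p` and `q` and adding leaves the conserved amplitude as a factor;
  -- excitation makes it nonzero.
  have e3 : Tendsto (fun t => (W i t - w) * (p 0 ^ 2 + q 0 ^ 2)) atTop (𝓝 0) := by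
    have := (lp.tendsto_mul_zero e2).add (lq.tendsto_mul_zero e1)
    rw [add_zero] at this
    refine this.congr' ?_
    filter_upwards [eventually_ge_atTop 0] with t ht
    rw [← hpq t ht]
    ring
  have e4 := (e3.div_const (p 0 ^ 2 + q 0 ^ 2)).add_const w
  rw [zero_div, zero_add] at e4
  refine e4.congr fun t => ?_
  rw [mul_div_cancel_right₀ _ h0.ne']
  ring

/-! ### The regulator equations in complex form -/

theorem oscMatrix_mulVec_zero {R : Type*} [CommRing R] {s : ℕ} (φ : ℝ →+* R) (ω : Fin s → ℝ)
    (z : Fin 2 × Fin s → R) (r : Fin s) :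
    ((oscMatrix ω).map φ *ᵥ z) (0, r) = φ (ω r) * z (1, r) := by
  simp [Matrix.mulVec, dotProduct, oscMatrix, Matrix.blockDiagonal_apply, Fintype.sum_prod_type,
    apply_ite φ]

theorem oscMatrix_mulVec_one {R : Type*} [CommRing R] {s : ℕ} (φ : ℝ →+* R) (ω : Fin s → ℝ)
    (z : Fin 2 × Fin s → R) (r : Fin s) :
    ((oscMatrix ω).map φ *ᵥ z) (1, r) = -φ (ω r) * z (0, r) := by
  simp [Matrix.mulVec, dotProduct, oscMatrix, Matrix.blockDiagonal_apply, Fintype.sum_prod_type,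
    apply_ite φ]

theorem mul_I_mem_spectrum_oscMatrix {s : ℕ} (w : Fin s → ℝ) (r : Fin s) :
    (w r * Complex.I : ℂ) ∈ spectrum ℂ ((oscMatrix w).map Complex.ofReal) := by
  rw [spectrum.mem_iff, ← Matrix.mulVec_injective_iff_isUnit]
  intro hinj
  -- The eigenvector is `(1, i)` in block `r` and zero elsewhere.
  set z : Fin 2 × Fin s → ℂ := fun k => if k.2 = r then ![1, Complex.I] k.1 else 0 with hz
  have hz0 : z = 0 := by
    refine hinj ?_
    rw [Matrix.mulVec_zero, Matrix.sub_mulVec, sub_eq_zero, Matrix.algebraMap_eq_diagonal]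
    ext ⟨k, l⟩
    rw [Matrix.mulVec_diagonal]
    fin_cases k
    · refine Eq.trans ?_ (oscMatrix_mulVec_zero Complex.ofRealHom w z l).symm
      by_cases hl : l = r <;> simp [hz, hl]
    · refine Eq.trans ?_ (oscMatrix_mulVec_one Complex.ofRealHom w z l).symm
      by_cases hl : l = r
      · simp [hz, hl, mul_assoc]
      · simp [hz, hl]
  have := congrFun hz0 (0, r)
  simp [hz] at this

/-- The two columns of block `r` as real and imaginary part of a complex vector. -/
def complexColumn {α : Type*} {s : ℕ} (M : Matrix α (Fin 2 × Fin s) ℝ) (r : Fin s) : α → ℂ :=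
  fun i => ⟨M i (0, r), M i (1, r)⟩

/-- The real matrix with given complex columns. -/
def ofComplexColumns {α : Type*} {s : ℕ} (y : Fin s → α → ℂ) : Matrix α (Fin 2 × Fin s) ℝ :=
  Matrix.of fun i k => ![(y k.2 i).re, (y k.2 i).im] k.1

section complexColumn

variable {α β : Type*} {s : ℕ}

theorem complexColumn_ofComplexColumns (y : Fin s → α → ℂ) (r : Fin s) :
    complexColumn (ofComplexColumns y) r = y r := by
  ext i
  simp [complexColumn, ofComplexColumns]

theorem ofComplexColumns_complexColumn (M : Matrix α (Fin 2 × Fin s) ℝ) :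
    ofComplexColumns (complexColumn M) = M := by
  ext i ⟨k, r⟩
  fin_cases k <;> simp [complexColumn, ofComplexColumns]

theorem eq_iff_complexColumn_eq {M M' : Matrix α (Fin 2 × Fin s) ℝ} :
    M = M' ↔ ∀ r, complexColumn M r = complexColumn M' r := by
  refine ⟨fun h r => h ▸ rfl, fun h => ?_⟩
  rw [← ofComplexColumns_complexColumn M, ← ofComplexColumns_complexColumn M']
  exact congrArg _ (funext h)

theorem complexColumn_add (M M' : Matrix α (Fin 2 × Fin s) ℝ) (r : Fin s) :
    complexColumn (M + M') r = complexColumn M r + complexColumn M' r := rfl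

theorem complexColumn_zero (r : Fin s) :
    complexColumn (0 : Matrix α (Fin 2 × Fin s) ℝ) r = 0 := rfl

theorem complexColumn_mul [Fintype β] (A : Matrix α β ℝ) (M : Matrix β (Fin 2 × Fin s) ℝ)
    (r : Fin s) : complexColumn (A * M) r = A.map Complex.ofReal *ᵥ complexColumn M r := by
  ext i
  apply Complex.ext <;> simp [complexColumn, Matrix.mul_apply, Matrix.mulVec, dotProduct]

/-- Right multiplication by a real rotation block becomes scalar multiplication by `i ω r`, which
decouples the Sylvester-type equation into independent linear systems. -/
theorem complexColumn_mul_oscMatrix (M : Matrix α (Fin 2 × Fin s) ℝ) (ω : Fin s → ℝ)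
    (r : Fin s) :
    complexColumn (M * oscMatrix ω) r = (ω r * Complex.I : ℂ) • complexColumn M r := by
  ext i
  apply Complex.ext <;>
    simp [complexColumn, Matrix.mul_apply, oscMatrix, Matrix.blockDiagonal_apply,
      Fintype.sum_prod_type, mul_comm]

theorem continuous_ofComplexColumns :
    Continuous (ofComplexColumns : (Fin s → α → ℂ) → Matrix α (Fin 2 × Fin s) ℝ) := by
  refine continuous_matrix fun i ⟨k, r⟩ => ?_
  fin_cases k
  · exact Complex.continuous_re.comp ((continuous_apply i).comp (continuous_apply r))
  · exact Complex.continuous_im.comp ((continuous_apply i).comp (continuous_apply r))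

end complexColumn

theorem tendsto_mulVec {𝕜 α β γ : Type*} [NormedField 𝕜] [Fintype β] {l : Filter γ}
    {M : γ → Matrix α β 𝕜} {M₀ : Matrix α β 𝕜} {v : γ → β → 𝕜} {v₀ : β → 𝕜}
    (hM : Tendsto M l (𝓝 M₀)) (hv : Tendsto v l (𝓝 v₀)) :
    Tendsto (fun t => M t *ᵥ v t) l (𝓝 (M₀ *ᵥ v₀)) := by
  refine tendsto_pi_nhds.2 fun i => tendsto_finsetSum _ fun j _ => ?_
  exact (tendsto_pi_nhds.1 (tendsto_pi_nhds.1 hM i) j).mul (tendsto_pi_nhds.1 hv j)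

theorem Matrix.exists_mul_eq_one_of_rank_eq_card {α β : Type*} [Fintype α] [Fintype β]
    [DecidableEq α] {M : Matrix α β ℂ} (h : M.rank = Fintype.card α) :
    ∃ R : Matrix β α ℂ, M * R = 1 := by
  classical
  rw [← Matrix.mulVec_surjective_iff_exists_right_inverse]
  have h1 : M.mulVecLin.range = ⊤ := by
    refine Submodule.eq_top_of_finrank_eq ?_
    rw [Module.finrank_fintype_fun_eq_card]
    exact h
  exact LinearMap.range_eq_top.1 h1

namespace Follower

variable {n m p s : ℕ} (f : Follower n m p s)

/-- The Rosenbrock matrix `[A - μ I, B; C, 0]`. -/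
noncomputable def rosenbrock (μ : ℂ) : Matrix (Fin n ⊕ Fin p) (Fin n ⊕ Fin m) ℂ :=
  Matrix.fromBlocks (f.A.map Complex.ofReal - μ • (1 : Matrix (Fin n) (Fin n) ℂ))
    (f.B.map Complex.ofReal) (f.C.map Complex.ofReal) 0

theorem continuous_rosenbrock : Continuous f.rosenbrock :=
  Continuous.matrix_fromBlocks (by fun_prop) continuous_const continuous_const continuous_const

theorem mem_regulatorSolutions_iff (ω : Fin s → ℝ)
    (z : Matrix (Fin n) (Fin 2 × Fin s) ℝ × Matrix (Fin m) (Fin 2 × Fin s) ℝ) :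
    z ∈ f.regulatorSolutions (oscMatrix ω) ↔
      ∀ r, f.rosenbrock (ω r * Complex.I) *ᵥ Sum.elim (complexColumn z.1 r) (complexColumn z.2 r)
        = Sum.elim (-complexColumn f.D r) (-complexColumn f.F r) := by
  change (z.1 * oscMatrix ω = f.A * z.1 + f.B * z.2 + f.D ∧ 0 = f.C * z.1 + f.F) ↔ _
  rw [eq_iff_complexColumn_eq, eq_iff_complexColumn_eq, ← forall_and]
  refine forall_congr' fun r => ?_
  rw [rosenbrock, Matrix.fromBlocks_mulVec, Sum.elim_eq_iff]
  simp only [complexColumn_add, complexColumn_mul_oscMatrix, complexColumn_zero]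
  simp only [complexColumn_mul, Sum.elim_comp_inl, Sum.elim_comp_inr, Matrix.sub_mulVec, Matrix.smul_mulVec, Matrix.one_mulVec,
    Matrix.zero_mulVec, add_zero]
  refine and_congr ?_ ?_
  · rw [← sub_eq_zero, eq_neg_iff_add_eq_zero, ← neg_eq_zero]
    congr! 1
    abel
  · rw [eq_neg_iff_add_eq_zero, eq_comm]

variable {f} {w : Fin s → ℝ}

theorem NonResonant.exists_rightInverse (h : f.NonResonant (oscMatrix w)) (r : Fin s) :
    ∃ R : Matrix (Fin n ⊕ Fin m) (Fin n ⊕ Fin p) ℂ, f.rosenbrock (w r * Complex.I) * R = 1 :=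
  Matrix.exists_mul_eq_one_of_rank_eq_card <| by
    simpa [rosenbrock] using h _ (mul_I_mem_spectrum_oscMatrix w r)

theorem NonResonant.regulatorSolutions_nonempty (h : f.NonResonant (oscMatrix w)) :
    (f.regulatorSolutions (oscMatrix w)).Nonempty := by
  choose R hR using NonResonant.exists_rightInverse h
  set y := fun r => R r *ᵥ Sum.elim (-complexColumn f.D r) (-complexColumn f.F r) with hy
  refine ⟨(ofComplexColumns fun r => y r ∘ Sum.inl, ofComplexColumns fun r => y r ∘ Sum.inr),
    (f.mem_regulatorSolutions_iff w _).2 fun r => ?_⟩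
  rw [complexColumn_ofComplexColumns, complexColumn_ofComplexColumns, Sum.elim_comp_inl_inr, hy,
    Matrix.mulVec_mulVec, hR, Matrix.one_mulVec]

/-- Through every solution of the regulator equations at nonresonant frequencies there passes a
family of solutions for the neighbouring frequencies. -/
theorem NonResonant.exists_continuousAt_solution (h : f.NonResonant (oscMatrix w))
    {z₀ : Matrix (Fin n) (Fin 2 × Fin s) ℝ × Matrix (Fin m) (Fin 2 × Fin s) ℝ}
    (hz₀ : z₀ ∈ f.regulatorSolutions (oscMatrix w)) :
    ∃ ζ : (Fin s → ℝ) → Matrix (Fin n) (Fin 2 × Fin s) ℝ × Matrix (Fin m) (Fin 2 × Fin s) ℝ,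
      ContinuousAt ζ w ∧ ζ w = z₀ ∧ ∀ᶠ ω in 𝓝 w, ζ ω ∈ f.regulatorSolutions (oscMatrix ω) := by
  choose R hR using NonResonant.exists_rightInverse h
  set b : Fin s → Fin n ⊕ Fin p → ℂ := fun r =>
    Sum.elim (-complexColumn f.D r) (-complexColumn f.F r) with hb
  set y₀ : Fin s → Fin n ⊕ Fin m → ℂ := fun r =>
    Sum.elim (complexColumn z₀.1 r) (complexColumn z₀.2 r) with hy₀
  set M : Fin s → (Fin s → ℝ) → Matrix (Fin n ⊕ Fin p) (Fin n ⊕ Fin m) ℂ := fun r ω =>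
    f.rosenbrock (ω r * Complex.I) with hM
  have hMcont : ∀ r, Continuous (M r) := fun r => f.continuous_rosenbrock.comp (by fun_prop)
  -- The solution `y₀` at `w` is corrected through the fixed right inverse `R r` of `M r w`. The
  -- residual `b r - M r ω *ᵥ y₀ r` is zero at `ω = w`, and the corrected vector is exact wherever
  -- `M r ω * R r` is invertible, hence near `w`.
  set y : (Fin s → ℝ) → Fin s → Fin n ⊕ Fin m → ℂ := fun ω r =>
    y₀ r + R r *ᵥ ((M r ω * R r)⁻¹ *ᵥ (b r - M r ω *ᵥ y₀ r)) with hy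
  have hbase : ∀ r, M r w *ᵥ y₀ r = b r := (f.mem_regulatorSolutions_iff w z₀).1 hz₀
  have hdet : ∀ r, (M r w * R r).det = 1 := fun r => by rw [hM, hR, Matrix.det_one]
  have hycont : ContinuousAt y w := by
    refine continuousAt_pi.2 fun r => ?_
    have hinv : ContinuousAt (fun ω => (M r ω * R r)⁻¹) w := by
      refine ContinuousAt.comp (g := Inv.inv) (f := fun ω => M r ω * R r) ?_
        ((hMcont r).matrix_mul continuous_const).continuousAt
      refine continuousAt_matrix_inv _ ?_
      rw [hdet, Ring.inverse_eq_inv']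
      exact continuousAt_inv₀ one_ne_zero
    have hres : ContinuousAt (fun ω => b r - M r ω *ᵥ y₀ r) w :=
      (continuous_const.sub ((hMcont r).matrix_mulVec continuous_const)).continuousAt
    exact tendsto_const_nhds.add (tendsto_mulVec tendsto_const_nhds (tendsto_mulVec hinv hres))
  refine ⟨fun ω => (ofComplexColumns fun r => y ω r ∘ Sum.inl,
    ofComplexColumns fun r => y ω r ∘ Sum.inr), ?_, ?_, ?_⟩
  · have hc : Continuous fun y : Fin s → Fin n ⊕ Fin m → ℂ =>
        ((ofComplexColumns fun r => y r ∘ Sum.inl, ofComplexColumns fun r => y r ∘ Sum.inr) :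
          Matrix (Fin n) (Fin 2 × Fin s) ℝ × Matrix (Fin m) (Fin 2 × Fin s) ℝ) :=
      (continuous_ofComplexColumns.comp (by fun_prop)).prodMk
        (continuous_ofComplexColumns.comp (by fun_prop))
    exact hc.continuousAt.comp hycont
  · have hyw : ∀ r, y w r = y₀ r := fun r => by
      simp only [hy]
      rw [hbase, sub_self, Matrix.mulVec_zero, Matrix.mulVec_zero, add_zero]
    refine Prod.ext ?_ ?_
    · simp only [hyw]
      exact ofComplexColumns_complexColumn z₀.1
    · simp only [hyw]
      exact ofComplexColumns_complexColumn z₀.2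
  · have hne : ∀ᶠ ω in 𝓝 w, ∀ r, (M r ω * R r).det ≠ 0 := by
      refine eventually_all.2 fun r => ?_
      refine ((hMcont r).matrix_mul continuous_const).matrix_det.continuousAt.eventually_ne ?_
      rw [hdet]
      exact one_ne_zero
    filter_upwards [hne] with ω hω
    refine (f.mem_regulatorSolutions_iff ω _).2 fun r => ?_
    rw [complexColumn_ofComplexColumns, complexColumn_ofComplexColumns, Sum.elim_comp_inl_inr]
    change M r ω *ᵥ y ω r = b r
    simp only [hy]
    rw [Matrix.mulVec_add, Matrix.mulVec_mulVec, Matrix.mulVec_mulVec,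
      Matrix.mul_nonsing_inv _ (isUnit_iff_ne_zero.2 (hω r)), Matrix.one_mulVec,
      add_sub_cancel]

end Follower

/-! ### Continuity of the optimal selection -/

/-- Continuity of the minimizer of a positive definite quadratic form over a set that depends
continuously on a parameter. -/
theorem continuousAt_of_isMinimizer {Ω V : Type*} [TopologicalSpace Ω] [NormedAddCommGroup V]
    [NormedSpace ℝ V] [FiniteDimensional ℝ V] {φ : V → ℝ} (hφ : Continuous φ)
    (hhom : ∀ (c : ℝ) z, φ (c • z) = c ^ 2 * φ z) (hpos : ∀ z, z ≠ 0 → 0 < φ z)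
    (hpar : ∀ x y, φ (x + y) + φ (x - y) = 2 * φ x + 2 * φ y)
    {S : Ω → Set V} {w : Ω} {sol : Ω → V} (hconv : Convex ℝ (S w))
    (hclosed : IsClosed {q : Ω × V | q.2 ∈ S q.1}) (hmem : ∀ᶠ ω in 𝓝 w, sol ω ∈ S ω)
    (hopt : ∀ ω, ∀ z ∈ S ω, φ (sol ω) ≤ φ z) {ζ : Ω → V} (hζ : ContinuousAt ζ w)
    (hζw : ζ w = sol w) (hζmem : ∀ᶠ ω in 𝓝 w, ζ ω ∈ S ω) : ContinuousAt sol w := by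
  have : ProperSpace V := FiniteDimensional.proper ℝ V
  obtain ⟨c, hc, hcoer⟩ := exists_pos_mul_norm_sq_le hφ hhom hpos
  have hlim : Tendsto (fun ω => φ (ζ ω)) (𝓝 w) (𝓝 (φ (sol w))) := by
    rw [← hζw]
    exact hφ.continuousAt.comp hζ
  have hle : ∀ᶠ ω in 𝓝 w, φ (sol ω) ≤ φ (ζ ω) := hζmem.mono fun ω h => hopt ω _ h
  -- Coercivity bounds `‖sol ω‖²` by `B - 1`, which forces `‖sol ω‖ ≤ B`.
  set B := (φ (sol w) + 1) / c + 1 with hB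
  have hball : ∀ᶠ ω in 𝓝 w, sol ω ∈ Metric.closedBall (0 : V) B := by
    filter_upwards [hle, hlim.eventually_le_const (lt_add_one _)] with ω h1 h2
    rw [mem_closedBall_zero_iff]
    have h3 : ‖sol ω‖ ^ 2 ≤ (φ (sol w) + 1) / c := by
      rw [le_div_iff₀ hc]
      linarith [hcoer (sol ω)]
    nlinarith [norm_nonneg (sol ω)]
  -- By compactness `sol` converges along each ultrafilter below `𝓝 w`; it remains to see that the
  -- limit `z` is always `sol w`. It is feasible by the closed graph, and comparison with the family
  -- `ζ` shows that its cost is no larger than the minimum.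
  refine (tendsto_iff_ultrafilter _ _ _).2 fun g hg => ?_
  obtain ⟨z, -, hz⟩ := (isCompact_closedBall (0 : V) B).ultrafilter_le_nhds (g.map sol)
    (le_principal_iff.2 (hg hball))
  have hz' : Tendsto sol g (𝓝 z) := hz
  have hzS : z ∈ S w := by
    have h1 : Tendsto (fun ω => (ω, sol ω)) (g : Filter Ω) (𝓝 (w, z)) := by
      rw [nhds_prod_eq]
      exact Tendsto.prodMk hg hz'
    exact hclosed.mem_of_tendsto h1 (hg hmem)
  have hzle : φ z ≤ φ (sol w) :=
    le_of_tendsto_of_tendsto ((hφ.tendsto z).comp hz') (hlim.mono_left hg) (hg hle)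
  -- Uniqueness of the minimizer: the midpoint is feasible, so the parallelogram identity forces `φ
  -- (z - sol w) ≤ 0`.
  have hmid := hopt w _ (hconv hzS hmem.self_of_nhds (by norm_num : (0 : ℝ) ≤ 1 / 2)
    (by norm_num : (0 : ℝ) ≤ 1 / 2) (by norm_num))
  rw [← smul_add, hhom] at hmid
  have hdiff : φ (z - sol w) ≤ 0 := by
    have := hpar z (sol w)
    linarith
  have : z = sol w := by
    by_contra hne
    exact absurd (hpos _ (sub_ne_zero.2 hne)) hdiff.not_gt
  rwa [this] at hz'

section trace

variable {α β : Type*} [Fintype α] [Fintype β]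

/-- A positive semidefinite matrix of trace zero vanishes, and the diagonal entries of `Xᵀ Q X` are
the values of `Q` on the columns of `X`. -/
theorem Matrix.PosDef.trace_transpose_mul_mul_pos {Q : Matrix α α ℝ} (hQ : Q.PosDef)
    {X : Matrix α β ℝ} (hX : X ≠ 0) : 0 < (Xᵀ * Q * X).trace := by
  have hps : (Xᵀ * Q * X).PosSemidef := by
    simpa using hQ.posSemidef.conjTranspose_mul_mul_same X
  refine lt_of_le_of_ne hps.trace_nonneg fun h => hX ?_
  have h0 : Xᵀ * Q * X = 0 := hps.trace_eq_zero_iff.1 h.symm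
  ext i j
  by_contra hne
  have hcol : X.col j ≠ 0 := fun h => hne (congrFun h i)
  have h1 := hQ.dotProduct_mulVec_pos hcol
  have h2 := congrFun (congrFun h0 j) j
  rw [Matrix.mul_assoc, Matrix.mul_apply] at h2
  exact h1.ne' h2

theorem Matrix.PosDef.trace_transpose_mul_mul_nonneg {Q : Matrix α α ℝ} (hQ : Q.PosDef)
    (X : Matrix α β ℝ) : 0 ≤ (Xᵀ * Q * X).trace := by
  rcases eq_or_ne X 0 with rfl | hX
  · simp
  · exact (hQ.trace_transpose_mul_mul_pos hX).le

end trace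

theorem Follower.IsOptimalRule.continuousAt {n m p s : ℕ} {f : Follower n m p s} {w : Fin s → ℝ}
    {Q : Matrix (Fin n) (Fin n) ℝ} {R : Matrix (Fin m) (Fin m) ℝ} (hQ : Q.PosDef) (hR : R.PosDef)
    {sol : (Fin s → ℝ) → Matrix (Fin n) (Fin 2 × Fin s) ℝ × Matrix (Fin m) (Fin 2 × Fin s) ℝ}
    (hrank : f.NonResonant (oscMatrix w)) (hsol : f.IsSolutionRule sol)
    (hopt : f.IsOptimalRule Q R sol) : ContinuousAt sol w := by
  obtain ⟨ζ, hζ, hζw, hζmem⟩ :=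
    hrank.exists_continuousAt_solution (hsol w hrank.regulatorSolutions_nonempty)
  let i₁ : NormedAddCommGroup (Matrix (Fin n) (Fin 2 × Fin s) ℝ) := Matrix.normedAddCommGroup
  let i₂ : NormedAddCommGroup (Matrix (Fin m) (Fin 2 × Fin s) ℝ) := Matrix.normedAddCommGroup
  let i₃ : NormedSpace ℝ (Matrix (Fin n) (Fin 2 × Fin s) ℝ) := Matrix.normedSpace
  let i₄ : NormedSpace ℝ (Matrix (Fin m) (Fin 2 × Fin s) ℝ) := Matrix.normedSpace
  refine continuousAt_of_isMinimizer
    (φ := fun z : Matrix (Fin n) (Fin 2 × Fin s) ℝ × Matrix (Fin m) (Fin 2 × Fin s) ℝ =>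
      (z.1ᵀ * Q * z.1 + z.2ᵀ * R * z.2).trace)
    (S := fun ω => f.regulatorSolutions (oscMatrix ω)) ?_ ?_ ?_ ?_ ?_ ?_ ?_ hopt hζ hζw hζmem
  · exact Continuous.matrix_trace (((continuous_fst.matrix_transpose.matrix_mul
      continuous_const).matrix_mul continuous_fst).add ((continuous_snd.matrix_transpose.matrix_mul
      continuous_const).matrix_mul continuous_snd))
  · intro c z
    simp [Matrix.transpose_smul, ← mul_assoc]
    ring
  · intro z hz
    rw [Matrix.trace_add]
    by_cases h1 : z.1 = 0
    · have h2 : z.2 ≠ 0 := fun h2 => hz (Prod.ext h1 h2)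
      exact add_pos_of_nonneg_of_pos (hQ.trace_transpose_mul_mul_nonneg _)
        (hR.trace_transpose_mul_mul_pos h2)
    · exact add_pos_of_pos_of_nonneg (hQ.trace_transpose_mul_mul_pos h1)
        (hR.trace_transpose_mul_mul_nonneg _)
  · intro x y
    simp only [Prod.fst_add, Prod.snd_add, Prod.fst_sub, Prod.snd_sub, Matrix.transpose_add,
      Matrix.transpose_sub, Matrix.add_mul, Matrix.mul_add, Matrix.sub_mul, Matrix.mul_sub,
      Matrix.trace_add, Matrix.trace_sub]
    ring
  · rintro x ⟨hx1, hx2⟩ y ⟨hy1, hy2⟩ a b - - hab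
    constructor
    · simp only [Prod.fst_add, Prod.snd_add, Prod.smul_fst, Prod.smul_snd, Matrix.add_mul,
        Matrix.mul_add, Matrix.smul_mul, Matrix.mul_smul, hx1, hy1]
      have : f.D = a • f.D + b • f.D := by rw [← add_smul, hab, one_smul]
      rw [smul_add, smul_add, smul_add, smul_add]
      nth_rewrite 3 [this]
      abel
    · simp only [Prod.fst_add, Prod.smul_fst, Matrix.mul_add, Matrix.mul_smul]
      have : f.F = a • f.F + b • f.F := by rw [← add_smul, hab, one_smul]
      rw [this]
      calc (0 : Matrix (Fin p) (Fin 2 × Fin s) ℝ) = a • (f.C * x.1 + f.F) + b • (f.C * y.1 + f.F) := by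
            rw [← hx2, ← hy2]; simp
        _ = _ := by rw [smul_add, smul_add]; abel
  · have hosc : Continuous fun ω : Fin s → ℝ => oscMatrix ω := by
      refine Continuous.matrix_blockDiagonal (continuous_pi fun r => continuous_matrix fun i j => ?_)
      fin_cases i <;> fin_cases j <;> simp <;> fun_prop
    have hE : Continuous fun q : (Fin s → ℝ) ×
        (Matrix (Fin n) (Fin 2 × Fin s) ℝ × Matrix (Fin m) (Fin 2 × Fin s) ℝ) => oscMatrix q.1 :=
      hosc.comp continuous_fst
    have hX : Continuous fun q : (Fin s → ℝ) ×
        (Matrix (Fin n) (Fin 2 × Fin s) ℝ × Matrix (Fin m) (Fin 2 × Fin s) ℝ) => q.2.1 :=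
      continuous_fst.comp continuous_snd
    have hU : Continuous fun q : (Fin s → ℝ) ×
        (Matrix (Fin n) (Fin 2 × Fin s) ℝ × Matrix (Fin m) (Fin 2 × Fin s) ℝ) => q.2.2 :=
      continuous_snd.comp continuous_snd
    exact (isClosed_eq (hX.matrix_mul hE) (((continuous_const.matrix_mul hX).add
      (continuous_const.matrix_mul hU)).add continuous_const)).inter
      (isClosed_eq continuous_const ((continuous_const.matrix_mul hX).add continuous_const))
  · exact hζmem.mono fun ω h => hsol ω ⟨_, h⟩

/-! ### Tracking and the closed loop -/

theorem observerMatrix_mulVec {s : ℕ} (a : Fin s → ℝ) (z : ExoSpace s) (k : Fin 2) (r : Fin s) :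
    (observerMatrix a *ᵥ z) (k, r) = -(a r * z (k, r)) := by
  fin_cases k <;>
    simp [Matrix.mulVec, dotProduct, observerMatrix, Matrix.blockDiagonal_apply,
      Fintype.sum_prod_type]

theorem IsBoundedLipschitz.exists_norm_le {ι : Type*} [Fintype ι] {f : ℝ → ι → ℝ}
    (h : ∀ i, IsBoundedLipschitz fun t => f t i) : ∃ M, ∀ t, 0 ≤ t → ‖f t‖ ≤ M := by
  choose M hM hb _ using h
  refine ⟨∑ i, M i, fun t ht => (pi_norm_le_iff_of_nonneg (Finset.sum_nonneg fun i _ => hM i)).2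
    fun i => (hb i t ht).trans (Finset.single_le_sum (fun i _ => hM i) (Finset.mem_univ i))⟩

theorem exists_norm_le_of_tendsto {E : Type*} [NormedAddCommGroup E] {f : ℝ → E} {c : E}
    (hf : ContinuousOn f (Ici 0)) (hlim : Tendsto f atTop (𝓝 c)) :
    ∃ M, ∀ t, 0 ≤ t → ‖f t‖ ≤ M := by
  obtain ⟨T, hT⟩ := eventually_atTop.1 (hlim.norm.eventually_le_const (lt_add_one ‖c‖))
  obtain ⟨M, hM⟩ := isCompact_Icc.exists_bound_of_continuousOn
    (hf.mono (Icc_subset_Ici_self : Icc 0 T ⊆ Ici 0))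
  refine ⟨max M (‖c‖ + 1), fun t ht => ?_⟩
  rcases le_total t T with h | h
  · exact (hM t ⟨ht, h⟩).trans (le_max_left _ _)
  · exact (hT t h).trans (le_max_right _ _)

theorem tendsto_mulVec_zero_of_isBoundedLipschitz {α β : Type*} [Fintype β]
    {M : ℝ → Matrix α β ℝ} {v : ℝ → β → ℝ} (hM : Tendsto M atTop (𝓝 0))
    (hv : ∀ j, IsBoundedLipschitz fun t => v t j) :
    Tendsto (fun t => M t *ᵥ v t) atTop (𝓝 0) := by
  refine tendsto_pi_nhds.2 fun i => ?_
  have h : Tendsto (fun t => ∑ j, v t j * M t i j) atTop (𝓝 (∑ _j : β, 0)) := by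
    refine tendsto_finsetSum _ fun j _ => (hv j).tendsto_mul_zero ?_
    exact tendsto_pi_nhds.1 (tendsto_pi_nhds.1 hM i) j
  rw [Finset.sum_const_zero] at h
  exact h.congr fun t => Finset.sum_congr rfl fun j _ => mul_comm _ _

/-- Tracking of a bounded exosystem by a stabilized follower whose gains and whose estimate of the
exosystem converge. -/
theorem Follower.regulation_of_estimates {n m p s : ℕ} (f : Follower n m p s)
    {E : Matrix (Fin 2 × Fin s) (Fin 2 × Fin s) ℝ} {K : Matrix (Fin m) (Fin n) ℝ}
    (hK : IsHurwitz (f.A - f.B * K))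
    {z : ℝ → Matrix (Fin n) (Fin 2 × Fin s) ℝ × Matrix (Fin m) (Fin 2 × Fin s) ℝ}
    {z₀ : Matrix (Fin n) (Fin 2 × Fin s) ℝ × Matrix (Fin m) (Fin 2 × Fin s) ℝ}
    (hz : Tendsto z atTop (𝓝 z₀)) (hz₀ : z₀ ∈ f.regulatorSolutions E)
    {v η : ℝ → ExoSpace s} {x : ℝ → Fin n → ℝ} (hv : ∀ k, IsBoundedLipschitz fun t => v t k)
    (hη : Tendsto (fun t => η t - v t) atTop (𝓝 0))
    (hvd : ∀ t, 0 ≤ t → HasDerivWithinAt v (E *ᵥ v t) (Ici 0) t)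
    (hx : ∀ t, 0 ≤ t → HasDerivWithinAt x
      (f.A *ᵥ x t + f.B *ᵥ controlInput K (z t) (x t) (η t) + f.D *ᵥ v t) (Ici 0) t) :
    Tendsto (fun t => x t - (z t).1 *ᵥ η t) atTop (𝓝 0) ∧
      Tendsto (fun t => f.trackingError (x t) (v t)) atTop (𝓝 0) ∧
      ∃ M, ∀ t, 0 ≤ t → ‖x t‖ ≤ M := by
  obtain ⟨hreg, hout⟩ := hz₀
  have hz1 : Tendsto (fun t => (z t).1) atTop (𝓝 z₀.1) := (continuous_fst.tendsto _).comp hz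
  set G := fun z : Matrix (Fin n) (Fin 2 × Fin s) ℝ × Matrix (Fin m) (Fin 2 × Fin s) ℝ =>
    K * z.1 + z.2 with hG
  have hGc : Continuous G :=
    (continuous_const.matrix_mul continuous_fst).add continuous_snd
  have hGz : Tendsto (fun t => G (z t)) atTop (𝓝 (G z₀)) := (hGc.tendsto _).comp hz
  -- The effect of replacing the ideal feedforward `G z₀ *ᵥ v` by the implemented one. It vanishes
  -- because the gains converge, `η - v → 0`, and `v` is bounded although it has no limit.
  set d := fun t => f.B *ᵥ (G (z t) *ᵥ η t - G z₀ *ᵥ v t) with hd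
  have hdlim : Tendsto d atTop (𝓝 0) := by
    refine tendsto_mulVec_zero f.B ?_
    have h1 := tendsto_mulVec hGz hη
    have h2 := tendsto_mulVec_zero_of_isBoundedLipschitz (tendsto_sub_nhds_zero_iff.2 hGz) hv
    have h3 := h1.add h2
    rw [Matrix.mulVec_zero, add_zero] at h3
    refine h3.congr fun t => ?_
    rw [Matrix.mulVec_sub, Matrix.sub_mulVec]
    abel
  set ξ := fun t => x t - z₀.1 *ᵥ v t with hξ
  have hξd : ∀ t, 0 ≤ t → HasDerivWithinAt ξ ((f.A - f.B * K) *ᵥ ξ t + d t) (Ici 0) t := by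
    intro t ht
    refine ((hx t ht).sub (hasDerivWithinAt_mulVec z₀.1 (hvd t ht))).congr_deriv ?_
    rw [Matrix.mulVec_mulVec, hreg]
    simp only [hξ, hd, hG, controlInput, Matrix.mulVec_sub, Matrix.mulVec_add, Matrix.sub_mulVec,
      Matrix.add_mulVec, Matrix.mulVec_neg, ← Matrix.mulVec_mulVec]
    abel
  have hξlim : Tendsto ξ atTop (𝓝 0) := hK.tendsto_zero_of_linear_ode hξd hdlim
  refine ⟨?_, ?_, ?_⟩
  · have h1 := tendsto_mulVec hz1 hη
    have h2 := tendsto_mulVec_zero_of_isBoundedLipschitz (tendsto_sub_nhds_zero_iff.2 hz1) hv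
    have h3 := (hξlim.sub h1).sub h2
    rw [Matrix.mulVec_zero, sub_zero, sub_zero] at h3
    refine h3.congr fun t => ?_
    simp only [hξ]
    rw [Matrix.mulVec_sub, Matrix.sub_mulVec]
    abel
  · refine (tendsto_mulVec_zero f.C hξlim).congr fun t => ?_
    have hF : f.F = -(f.C * z₀.1) := (neg_eq_of_add_eq_zero_right hout.symm).symm
    simp only [hξ, Follower.trackingError]
    rw [hF, Matrix.neg_mulVec, Matrix.mulVec_sub, Matrix.mulVec_mulVec, sub_eq_add_neg]
  · obtain ⟨M₁, hM₁⟩ := exists_norm_le_of_tendsto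
      (fun t ht => (hξd t ht).continuousWithinAt) hξlim
    obtain ⟨M₂, hM₂⟩ := IsBoundedLipschitz.exists_norm_le (f := fun t => z₀.1 *ᵥ v t) fun i =>
      .sum Finset.univ fun j => (IsBoundedLipschitz.const (z₀.1 i j)).mul (hv j)
    refine ⟨M₁ + M₂, fun t ht => ?_⟩
    have h : x t = ξ t + z₀.1 *ᵥ v t := by simp [hξ]
    rw [h]
    exact (norm_add_le _ _).trans (add_le_add (hM₁ t ht) (hM₂ t ht))

theorem theorem1 {N s : ℕ} {n m p : Fin N → ℕ}
    (𝒢 : Network N) (f : ∀ i, Follower (n i) (m i) (p i) s)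
    (w a κ : Fin s → ℝ)
    (K : ∀ i, Matrix (Fin (m i)) (Fin (n i)) ℝ)
    (sol : ∀ i, (Fin s → ℝ) →
      Matrix (Fin (n i)) (Fin 2 × Fin s) ℝ × Matrix (Fin (m i)) (Fin 2 × Fin s) ℝ)
    (v : ℝ → ExoSpace s) (x : ∀ i, ℝ → Fin (n i) → ℝ)
    (η : Fin N → ℝ → ExoSpace s) (wh : Fin N → ℝ → Fin s → ℝ)
    -- positive distinct frequencies, positive design parameters
    (hw : ∀ r, 0 < w r) (hw_inj : Function.Injective w)
    (ha : ∀ r, 0 < a r) (hκ : ∀ r, 0 < κ r)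
    -- stabilizability and observability
    (hstab : ∀ i, IsStabilizable (f i).A (f i).B)
    (hobs : ∀ i, IsObservable (f i).C (f i).A)
    -- the communication graph
    (hT : 𝒢.targets.Nonempty) (hconn : 𝒢.graph.Connected)
    -- the non-resonance rank condition
    (hrank : ∀ i, (f i).NonResonant (oscMatrix w))
    -- stabilizing feedback gains
    (hK : ∀ i, IsHurwitz ((f i).A - (f i).B * K i))
    -- solutions of the regulator equations written with the estimated frequencies,
    -- selected through a cost or in a way that is continuous at the true frequencies
    (hsol : ∀ i, (f i).IsSolutionRule (sol i))
    (hsel : ∀ i, (∃ Q R, Q.PosDef ∧ R.PosDef ∧ (f i).IsOptimalRule Q R (sol i)) ∨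
      ContinuousAt (sol i) w)
    -- every oscillator of the exosystem is excited
    (hv : ∀ r, ∃ k, v 0 (k, r) ≠ 0)
    (htraj : IsClosedLoopTrajectory 𝒢 f w a κ K sol v x η wh) :
    ∀ i,
      (∀ᶠ t in atTop, sol i (wh i t) ∈ (f i).regulatorSolutions (oscMatrix (wh i t))) ∧
      Tendsto (fun t => x i t - (sol i (wh i t)).1 *ᵥ η i t) atTop (𝓝 0) ∧
      Tendsto (fun t => (f i).trackingError (x i t) (v t)) atTop (𝓝 0) ∧
      ∃ M, ∀ t, 0 ≤ t → ‖x i t‖ ≤ M ∧ ‖η i t‖ ≤ M ∧ ‖wh i t‖ ≤ M := by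
  have osc0 : ∀ (ω : Fin s → ℝ) (z : ExoSpace s) r, (oscMatrix ω *ᵥ z) (0, r) = ω r * z (1, r) :=
    fun ω z r => oscMatrix_mulVec_zero (RingHom.id ℝ) ω z r
  have osc1 : ∀ (ω : Fin s → ℝ) (z : ExoSpace s) r, (oscMatrix ω *ᵥ z) (1, r) = -ω r * z (0, r) :=
    fun ω z r => oscMatrix_mulVec_one (RingHom.id ℝ) ω z r
  -- Both `oscMatrix` and `observerMatrix` act blockwise, and the graph mixes followers but not
  -- components, so each oscillator is a separate instance.
  have key := fun i r => adaptive_observer_converges (i := i) 𝒢.groundedLaplacian_isSymm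
    (𝒢.dotProduct_groundedLaplacian_pos hT hconn) (ha r) (hκ r)
    (p := fun t => v t (0, r)) (q := fun t => v t (1, r))
    (P := fun j t => η j t (0, r)) (Q := fun j t => η j t (1, r)) (W := fun j t => wh j t r)
    (w := w r)
    (ξ := fun t j => 𝒢.observationError (fun j => η j t) (v t) j (0, r))
    (ζ := fun t j => 𝒢.observationError (fun j => η j t) (v t) j (1, r))
    (fun t => funext fun j => 𝒢.observationError_apply _ _ _ _ _)
    (fun t => funext fun j => 𝒢.observationError_apply _ _ _ _ _)
    (fun t ht => (hasDerivWithinAt_pi.1 (htraj.exosystem t ht) (0, r)).congr_deriv (osc0 _ _ _))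
    (fun t ht => (hasDerivWithinAt_pi.1 (htraj.exosystem t ht) (1, r)).congr_deriv (osc1 _ _ _))
    (fun j t ht => (hasDerivWithinAt_pi.1 (htraj.observer j t ht) (0, r)).congr_deriv (by
      rw [Matrix.sub_mulVec, Pi.add_apply, Pi.sub_apply, osc0, osc0, observerMatrix_mulVec]
      ring))
    (fun j t ht => (hasDerivWithinAt_pi.1 (htraj.observer j t ht) (1, r)).congr_deriv (by
      rw [Matrix.sub_mulVec, Pi.add_apply, Pi.sub_apply, osc1, osc1, observerMatrix_mulVec]
      ring))
    (fun j t ht => htraj.adaptation j r t ht)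
    (by
      obtain ⟨k, hk⟩ := hv r
      fin_cases k
      · exact add_pos_of_pos_of_nonneg (sq_pos_of_ne_zero hk) (sq_nonneg _)
      · exact add_pos_of_nonneg_of_pos (sq_nonneg _) (sq_pos_of_ne_zero hk))
  intro i
  have hcont : ContinuousAt (sol i) w := by
    rcases hsel i with ⟨Q, R, hQ, hR, hopt⟩ | h
    · exact hopt.continuousAt hQ hR (hrank i) (hsol i)
    · exact h
  have hmem : sol i w ∈ (f i).regulatorSolutions (oscMatrix w) :=
    hsol i w (hrank i).regulatorSolutions_nonempty
  have hwh : Tendsto (wh i) atTop (𝓝 w) := tendsto_pi_nhds.2 fun r => (key i r).2.2.2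
  have hvb : ∀ k, IsBoundedLipschitz fun t => v t k := fun ⟨k, r⟩ => by
    fin_cases k
    exacts [(key i r).1.1, (key i r).1.2.1]
  have hηb : ∀ k, IsBoundedLipschitz fun t => η i t k := fun ⟨k, r⟩ => by
    fin_cases k
    exacts [(key i r).1.2.2.1, (key i r).1.2.2.2.1]
  have hηlim : Tendsto (fun t => η i t - v t) atTop (𝓝 0) := tendsto_pi_nhds.2 fun ⟨k, r⟩ => by
    fin_cases k
    exacts [(key i r).2.1, (key i r).2.2.1]
  obtain ⟨hstate, herror, M₁, hM₁⟩ := (f i).regulation_of_estimates (hK i)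
    (hcont.tendsto.comp hwh) hmem hvb hηlim htraj.exosystem (htraj.follower i)
  obtain ⟨M₂, hM₂⟩ := IsBoundedLipschitz.exists_norm_le hηb
  obtain ⟨M₃, hM₃⟩ := IsBoundedLipschitz.exists_norm_le fun r => (key i r).1.2.2.2.2
  refine ⟨?_, hstate, herror, max M₁ (max M₂ M₃), fun t ht => ⟨?_, ?_, ?_⟩⟩
  -- Solvability holds on a neighbourhood of `w`, which the estimates eventually enter.
  · obtain ⟨ζ, -, -, hζ⟩ := (hrank i).exists_continuousAt_solution hmem
    exact (hwh.eventually hζ).mono fun t h => hsol i _ ⟨_, h⟩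
  · exact (hM₁ t ht).trans (le_max_left _ _)
  · exact (hM₂ t ht).trans ((le_max_left _ _).trans (le_max_right _ _))
  · exact (hM₃ t ht).trans ((le_max_right _ _).trans (le_max_right _ _))
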